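/- Let $1\le m<N$ and $n\in\mathbb N$, and write $X=(x,y)\in\mathbb R^m\times\mathbb R^{N-m}=\mathbb R^N$. For $i=1,\dots,n$ let $a_i:\mathbb R^m\times(0,\infty)\to\mathbb R$ be such that $a_i\in L^\infty(\mathbb R^m\times[\alpha_-,\alpha_+])$ for all $\alpha_+>\alpha_->0$, $\inf_{x\in\mathbb R^m}a_i(x,t)>0$ for every $t>0$, and $t\mapsto a_i(x,t)$ is $C^1$ on $(0,\infty)$ for every $x$. Let $F=F(x,\xi^1,\dots,\xi^n)$ on $\mathbb R^m\times\mathbb R^n$ be such that $F(x,\cdot)\in C^2(\mathbb R^n)$ for every $x$, and denote by $F_i$, $F_{ij}$ its first and second partial derivatives with respect to $\xi^i$, and $\xi^i,\xi^j$. For $\eta\in\mathbb R^N\setminus\{0\}$ put $$\mathcal A^i_{pq}(x,\eta)=a_i(x,|\eta|)\,\delta_{pq}+\frac{\partial a_i}{\partial t}(x,|\eta|)\,\frac{\eta_p\eta_q}{|\eta|},\qquad 1\le p,q\le N .$$ Let $u=(u^1,\dots,u^n)$ satisfy $u^i\in C^1(\mathbb R^N)\cap C^2(\{\nabla u^i\ne0\})\cap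 L^\infty(\mathbb R^N)$ and $\nabla u^i\in L^\infty(\mathbb R^N,\mathbb R^N)\cap W^{1,2}_{loc}(\mathbb R^N,\mathbb R^N)$, and let $u$ be a weak solution in $\mathbb R^N$ of $$-\operatorname{div}\big(a_i(x,|\nabla u^i|)\nabla u^i\big)=F_i(x,u^1,\dots,u^n),\qquad i=1,\dots,n,$$ that is, $\int_{\mathbb R^N} a_i(x,|\nabla u^i|)\langle\nabla u^i,\nabla\psi^i\rangle\,dX=\int_{\mathbb R^N} F_i(x,u)\,\psi^i\,dX$ for all $\psi\in C_c^\infty(\mathbb R^N,\mathbb R^n)$ and all $i$, where $a_i(x,|\nabla u^i|)\nabla u^i$, $F_i(x,u(X))$ and also $F_{ij}(x,u(X))$ are locally integrable functions of $X\in\mathbb R^N$ for all $i,j$. Assume that: 1. ($F$-monotonicity) $\partial_{y_{N-m}}u^i(X)\neq0$ for all $X\in\mathbb R^N$ and all $i$, and $F_{ij}(x,u(X))\,\partial_{y_{N-m}}u^i(X)\,\partial_{y_{N-m}}u^j(X)\ge0$ for all $X\in\mathbb R^N$ and all $i<j$; 2. for every $i$ and every $R>0$, $X\mapsto\mathcal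 A^i(x,\nabla u^i(X))$ belongs to $L^\infty(\{\nabla u^i\ne0\}\cap B_R)$; 3. for every $i$, the matrix $\mathcal A^i(x,\nabla u^i(X))$ is positive definite for almost every $X\in\mathbb R^N$; 4. there are constants $C_1,\dots,C_n\ge1$ such that, with $\overline{\mathcal A}^i(X)$ the largest eigenvalue of $\mathcal A^i(x,\nabla u^i(X))$, $$\int_{B_R}\overline{\mathcal A}^i(X)\,|\nabla u^i(X)|^2\,dX\le C_iR^2\qquad\text{for all } R\ge\max\{C_1,\dots,C_n\},\ i=1,\dots,n .$$ Then there exist functions $\bar u^i:\mathbb R^m\times\mathbb R\to\mathbb R$ and constant directions $\omega_i\in\mathbb S^{N-m-1}$, $i=1,\dots,n$, such that $$u^i(x,y)=\bar u^i(x,\langle\omega_i,y\rangle)\qquad\text{for all }(x,y)\in\mathbb R^m\times\mathbb R^{N-m}.$$ If, in addition, there is an open set $U\subseteq\mathbb R^m\times\mathbb R^n$ which contains $(x,u(X))$ for at least one $X=(x,y)\in\mathbb R^N$ and is such that, for every $j,k\in\{1,\dots,n\}$, either $F_{jk}>0$ in $U$ or $F_{jk}<0$ in $U$, then the $\bar u^i$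 and $\omega_i$ can be chosen so that all the $\omega_i$ coincide. -/

import Mathlib

open MeasureTheory Set
open scoped ContDiff Gradient

namespace Fibered

noncomputable section

/-- `ℝ^d` with its Euclidean structure. -/
abbrev E (d : ℕ) := EuclideanSpace ℝ (Fin d)

/-- `ℝ^N = ℝ^m × ℝ^k` (so `k = N - m`) with its Euclidean structure; the coordinates indexed by
`Sum.inl` are those of `x`, the coordinates indexed by `Sum.inr` are those of `y`. -/
abbrev Pt (m k : ℕ) := EuclideanSpace ℝ (Fin m ⊕ Fin k)

variable {m k n : ℕ}

/-- The component `x` of `X = (x, y)`. -/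
def xPart (X : Pt m k) : E m := WithLp.toLp 2 fun a => X (Sum.inl a)

/-- The point `X = (x, y)`. -/
def mkPt (x : E m) (y : E k) : Pt m k := WithLp.toLp 2 (Sum.elim x y)

/-- The partial derivative of `f` with respect to the coordinate `p` of `ℝ^N`. -/
def pderiv (p : Fin m ⊕ Fin k) (f : Pt m k → ℝ) (X : Pt m k) : ℝ :=
  fderiv ℝ f X (EuclideanSpace.single p 1)

/-- Smooth functions with compact support. -/
def IsTest (ψ : Pt m k → ℝ) : Prop := ContDiff ℝ ∞ ψ ∧ HasCompactSupport ψ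

/-- `f ∈ L^2_loc(ℝ^N)`. -/
def MemL2loc (f : Pt m k → ℝ) : Prop :=
  ∀ R : ℝ, 0 < R → MemLp f 2 (volume.restrict (Metric.ball 0 R))

/-- `h` is the weak partial derivative of `g` with respect to the coordinate `p`. -/
def IsWeakPartial (p : Fin m ⊕ Fin k) (g h : Pt m k → ℝ) : Prop :=
  ∀ φ : Pt m k → ℝ, IsTest φ → ∫ X, g X * pderiv p φ X = -∫ X, h X * φ X

/-- `g ∈ W^{1,2}_loc(ℝ^N)`. -/
def MemW12loc (g : Pt m k → ℝ) : Prop :=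
  MemL2loc g ∧ ∀ p, ∃ h, MemL2loc h ∧ IsWeakPartial p g h

/-- The partial derivative `F_i = ∂F/∂ξ^i` at `(x, ξ)`. -/
def dF (F : E m → (Fin n → ℝ) → ℝ) (i : Fin n) (x : E m) (ξ : Fin n → ℝ) : ℝ :=
  fderiv ℝ (F x) ξ (Pi.single i 1)

/-- The second partial derivative `F_ij = ∂²F/∂ξ^i∂ξ^j` at `(x, ξ)`. -/
def ddF (F : E m → (Fin n → ℝ) → ℝ) (i j : Fin n) (x : E m) (ξ : Fin n → ℝ) : ℝ :=
  fderiv ℝ (dF F i x) ξ (Pi.single j 1)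

/-- The standing assumptions on a coefficient `a = a(x, t)`, `x ∈ ℝ^m`, `t > 0`. -/
structure IsCoefficient (a : E m → ℝ → ℝ) : Prop where
  memLinfty : ∀ α β : ℝ, 0 < α → α < β →
    MemLp (fun q : E m × ℝ => a q.1 q.2) ⊤ (volume.restrict (univ ×ˢ Icc α β))
  inf_pos : ∀ t : ℝ, 0 < t → ∃ c : ℝ, 0 < c ∧ ∀ x, c ≤ a x t
  contDiffOn : ∀ x, ContDiffOn ℝ 1 (a x) (Ioi 0)

/-- The matrix `a(x,|η|) δ_pq + ∂_t a(x,|η|) η_p η_q / |η|`, for `η ≠ 0`. -/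
def matA (a : E m → ℝ → ℝ) (x : E m) (η : Pt m k) :
    Matrix (Fin m ⊕ Fin k) (Fin m ⊕ Fin k) ℝ :=
  Matrix.of fun p q =>
    a x ‖η‖ * (if p = q then 1 else 0) + deriv (a x) ‖η‖ * (η p * η q / ‖η‖)

/-- The matrix field `X ↦ 𝒜(x, ∇u(X))`. -/
def matAlong (a : E m → ℝ → ℝ) (u : Pt m k → ℝ) (X : Pt m k) :
    Matrix (Fin m ⊕ Fin k) (Fin m ⊕ Fin k) ℝ :=
  matA a (xPart X) (∇ u X)

/-- The largest eigenvalue of a symmetric real matrix. -/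
def maxEigenvalue {ι : Type*} [Fintype ι] [DecidableEq ι] (M : Matrix ι ι ℝ) : ℝ :=
  sSup (spectrum ℝ M)

/-- `(u^1, …, u^n)` is a weak solution on `ℝ^N` of `-div (a_i(x,|∇u^i|) ∇u^i) = F_i(x,u)`.
The two local integrability clauses say that the integrals in the weak formulation exist. -/
structure IsWeakSolution (a : Fin n → E m → ℝ → ℝ) (F : E m → (Fin n → ℝ) → ℝ)
    (u : Fin n → Pt m k → ℝ) : Prop where
  locallyIntegrable_flux : ∀ i,
    LocallyIntegrable fun X => a i (xPart X) ‖∇ (u i) X‖ • ∇ (u i) X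
  locallyIntegrable_rhs : ∀ i,
    LocallyIntegrable fun X => dF F i (xPart X) fun l => u l X
  weak_eq : ∀ ψ : Fin n → Pt m k → ℝ, (∀ i, IsTest (ψ i)) → ∀ i,
    ∫ X, inner ℝ (a i (xPart X) ‖∇ (u i) X‖ • ∇ (u i) X) (∇ (ψ i) X) =
      ∫ X, dF F i (xPart X) (fun l => u l X) * ψ i X

/-- `u ∈ C^1(ℝ^N) ∩ C^2({∇u ≠ 0}) ∩ L^∞` and `∇u ∈ L^∞ ∩ W^{1,2}_loc`. As `u` and `∇u` are
continuous, membership in `L^∞` is boundedness. -/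
structure IsRegular (u : Pt m k → ℝ) : Prop where
  contDiff : ContDiff ℝ 1 u
  contDiffOn : ContDiffOn ℝ 2 u {X | ∇ u X ≠ 0}
  bounded : ∃ M : ℝ, ∀ X, |u X| ≤ M
  bounded_gradient : ∃ M : ℝ, ∀ X, ‖∇ u X‖ ≤ M
  gradient_memW12loc : ∀ p, MemW12loc (pderiv p u)

/-- `X ↦ 𝒜(x, ∇u(X))` belongs to `L^∞({∇u ≠ 0} ∩ B_R)` for every `R > 0`. -/
def MatLocallyBounded (a : E m → ℝ → ℝ) (u : Pt m k → ℝ) : Prop :=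
  ∀ R : ℝ, 0 < R → ∀ p q,
    MemLp (fun X => matAlong a u X p q) ⊤
      (volume.restrict ({X | ∇ u X ≠ 0} ∩ Metric.ball 0 R))

/-- `F`-monotonicity on `ℝ^N` in the direction of the coordinate `e` of `y`. -/
structure IsFMonotone (e : Fin k) (F : E m → (Fin n → ℝ) → ℝ) (u : Fin n → Pt m k → ℝ) :
    Prop where
  ne_zero : ∀ i X, pderiv (Sum.inr e) (u i) X ≠ 0
  nonneg : ∀ i j, i < j → ∀ X,
    0 ≤ ddF F i j (xPart X) (fun l => u l X) *
      pderiv (Sum.inr e) (u i) X * pderiv (Sum.inr e) (u j) X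

/-- The growth condition `∫_{B_R} λ_max(𝒜^i(x,∇u^i)) |∇u^i|² ≤ C_i R²` for
`R ≥ max {C_1, …, C_n}`. -/
def EnergyGrowth (a : Fin n → E m → ℝ → ℝ) (u : Fin n → Pt m k → ℝ) : Prop :=
  ∃ C : Fin n → ℝ, (∀ i, 1 ≤ C i) ∧ ∀ i, ∀ R : ℝ, (∀ j, C j ≤ R) →
    ∫⁻ X in Metric.ball (0 : Pt m k) R,
      ENNReal.ofReal (maxEigenvalue (matAlong (a i) (u i) X) * ‖∇ (u i) X‖ ^ 2) ≤
        ENNReal.ofReal (C i * R ^ 2)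

end

end Fibered

/-! Monotonicity rules out critical points, so each `u i` is of class C² on the whole space. Neither
the coefficients nor `F` depend explicitly on y, so the system can be differentiated in every
direction y_j without any regularity in x. The derivatives w^i = ∂_{y_j} u^i all solve the same
linear system -div(𝒜^i ∇w^i) = ∑_l F_il w^l (`linearized_eq`).

Let v_i be the nonvanishing derivative in the last y-coordinate and σ_i = ∂_{y_j} u^i / v_i. Then
-div(v_i² 𝒜^i ∇σ_i) = ∑_l F_il v_i v_l (σ_l - σ_i) weakly (`quotient_eq`). Testing with σ_i η² and
summing over i, the symmetry of F_il turns the right-hand side into minus a sum of squares with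
weights F_il v_i v_l, which are nonnegative for i ≠ l (`energy_eq`). The gradient energy plus this
coupling energy is thus controlled by a cutoff term supported in an annulus. Since v_i σ_i = ∂_{y_j}
u^i is bounded by |∇u^i|, the quadratic growth hypothesis exactly balances |∇η|² ~ r⁻². The energy
is therefore finite, hence small on annuli, hence zero (`energy_decay`, `liouville`).

Vanishing gradient energy makes every σ_i constant, so the y-gradient of u^i is v_i times a fixed
vector c_i, and u^i depends on y only through ⟨c_i, y⟩. Vanishing coupling energy gives c_i = c_l as
soon as F_il is nonzero on a set of positive measure. -/

namespace Fibered

/-! ### Partial derivatives and gradients in coordinates. -/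

section Calculus

variable {m k : ℕ}

/-- The vector of partial derivatives of `f` at `X`. -/
noncomputable def dvec (f : Pt m k → ℝ) (X : Pt m k) : Fin m ⊕ Fin k → ℝ := fun p => pderiv p f X

theorem gradient_apply (f : Pt m k → ℝ) (X : Pt m k) (p : Fin m ⊕ Fin k) :
    (∇ f X) p = pderiv p f X := by
  have h : inner ℝ (∇ f X) (EuclideanSpace.single p (1 : ℝ)) = pderiv p f X :=
    inner_gradient_left ..
  rw [← h, EuclideanSpace.inner_single_right]
  simp

theorem norm_gradient (f : Pt m k → ℝ) (X : Pt m k) :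
    ‖∇ f X‖ = √(∑ p, pderiv p f X ^ 2) := by
  rw [EuclideanSpace.norm_eq]
  simp only [gradient_apply, Real.norm_eq_abs, sq_abs]

theorem contDiff_pderiv {f : Pt m k → ℝ} {r s : WithTop ℕ∞} (hf : ContDiff ℝ r f)
    (hs : s + 1 ≤ r) (p : Fin m ⊕ Fin k) : ContDiff ℝ s (pderiv p f) :=
  (hf.fderiv_right hs).clm_apply contDiff_const

theorem continuous_pderiv {f : Pt m k → ℝ} (hf : ContDiff ℝ 1 f) (p : Fin m ⊕ Fin k) :
    Continuous (pderiv p f) :=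
  (contDiff_pderiv (s := 0) hf (by simp) p).continuous

theorem continuous_dvec {f : Pt m k → ℝ} (hf : ContDiff ℝ 1 f) : Continuous (dvec f) :=
  continuous_pi fun p => continuous_pderiv hf p

theorem hasCompactSupport_pderiv {f : Pt m k → ℝ} (hf : HasCompactSupport f)
    (p : Fin m ⊕ Fin k) : HasCompactSupport (pderiv p f) :=
  (hf.fderiv ℝ).comp_left (g := fun L : Pt m k →L[ℝ] ℝ => L (EuclideanSpace.single p 1)) rfl

theorem IsTest.pderiv {f : Pt m k → ℝ} (hf : IsTest f) (p : Fin m ⊕ Fin k) :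
    IsTest (pderiv p f) :=
  ⟨contDiff_pderiv hf.1 (by simp) p, hasCompactSupport_pderiv hf.2 p⟩

theorem pderiv_comm {f : Pt m k → ℝ} (hf : ContDiff ℝ 2 f) (p q : Fin m ⊕ Fin k)
    (X : Pt m k) : pderiv p (pderiv q f) X = pderiv q (pderiv p f) X := by
  have hd : DifferentiableAt ℝ (fderiv ℝ f) X :=
    ((hf.fderiv_right (m := 1) (by norm_num)).differentiable (by norm_num)) X
  have key : ∀ p q : Fin m ⊕ Fin k, pderiv p (pderiv q f) X =
      fderiv ℝ (fderiv ℝ f) X (EuclideanSpace.single p 1) (EuclideanSpace.single q 1) := by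
    intro p q
    unfold pderiv
    rw [fderiv_clm_apply hd (differentiableAt_const _)]
    simp
  rw [key, key]
  exact hf.contDiffAt.isSymmSndFDerivAt (by simp) _ _

theorem pderiv_mul {f g : Pt m k → ℝ} {X : Pt m k} (hf : DifferentiableAt ℝ f X)
    (hg : DifferentiableAt ℝ g X) (p : Fin m ⊕ Fin k) :
    pderiv p (fun Y => f Y * g Y) X = f X * pderiv p g X + g X * pderiv p f X := by
  unfold pderiv
  rw [fderiv_fun_mul hf hg]
  simp

theorem dvec_mul {f g : Pt m k → ℝ} {X : Pt m k} (hf : DifferentiableAt ℝ f X)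
    (hg : DifferentiableAt ℝ g X) :
    dvec (fun Y => f Y * g Y) X = f X • dvec g X + g X • dvec f X :=
  funext fun p => pderiv_mul hf hg p

theorem hasLineDerivAt_pderiv {f : Pt m k → ℝ} {X : Pt m k} (hf : DifferentiableAt ℝ f X)
    (p : Fin m ⊕ Fin k) : HasLineDerivAt ℝ f (pderiv p f X) X (EuclideanSpace.single p 1) :=
  hf.hasFDerivAt.hasLineDerivAt _

end Calculus

/-! ### Local integrability of products. -/

section LocallyIntegrable

variable {m k : ℕ}

theorem integrable_mul_of_hasCompactSupport {f g : Pt m k → ℝ} (hf : LocallyIntegrable f)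
    (hg : Continuous g) (hgc : HasCompactSupport g) : Integrable fun X => f X * g X :=
  hf.integrable_smul_right_of_hasCompactSupport hg hgc

theorem locallyIntegrable_mul_continuous {f g : Pt m k → ℝ} (hf : LocallyIntegrable f)
    (hg : Continuous g) : LocallyIntegrable fun X => f X * g X :=
  locallyIntegrable_iff.2 fun _ hK =>
    (hf.integrableOn_isCompact hK).mul_continuousOn hg.continuousOn hK

theorem locallyIntegrable_apply {f : Pt m k → Pt m k} (hf : LocallyIntegrable f)
    (p : Fin m ⊕ Fin k) : LocallyIntegrable fun X => f X p :=
  locallyIntegrable_iff.2 fun _ hK =>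
    (EuclideanSpace.proj p : Pt m k →L[ℝ] ℝ).integrable_comp
      (hf.integrableOn_isCompact hK)

theorem locallyIntegrable_of_memLp_top {f : Pt m k → ℝ}
    (hf : ∀ R : ℝ, 0 < R → MemLp f ⊤ (volume.restrict (Metric.ball 0 R))) :
    LocallyIntegrable f := by
  refine locallyIntegrable_iff.2 fun K hK => ?_
  obtain ⟨R, hR, hKR⟩ := hK.isBounded.subset_ball_lt 0 0
  have : IsFiniteMeasure (volume.restrict (Metric.ball (0 : Pt m k) R)) :=
    ⟨by simpa using measure_ball_lt_top⟩
  exact IntegrableOn.mono_set ((hf R hR).integrable le_top) hKR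

end LocallyIntegrable

/-! ### From smooth to C¹ test functions. -/

section Mollification

variable {m k : ℕ}

/-- Mollification at a scale below the moduli of uniform continuity of φ and its partial
derivatives. It is needed because the energy argument tests with functions built from derivatives of
u, which are only C¹. -/
theorem exists_isTest_approx {φ : Pt m k → ℝ} (hφ : ContDiff ℝ 1 φ) (hφc : HasCompactSupport φ)
    {δ : ℝ} (hδ : 0 < δ) :
    ∃ ψ : Pt m k → ℝ, IsTest ψ ∧ (∀ X ∉ Metric.cthickening 1 (tsupport φ), ψ X = 0) ∧
      (∀ X, |ψ X - φ X| ≤ δ) ∧ ∀ p X, |pderiv p ψ X - pderiv p φ X| ≤ δ := by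
  have huc : UniformContinuous φ := hφc.uniformContinuous_of_continuous hφ.continuous
  have hup : ∀ p, UniformContinuous (pderiv p φ) := fun p =>
    (hasCompactSupport_pderiv hφc p).uniformContinuous_of_continuous (continuous_pderiv hφ p)
  obtain ⟨ε₀, hε₀, h₀⟩ := Metric.uniformContinuous_iff.1 huc δ hδ
  choose ε₁ hε₁ h₁ using fun p => Metric.uniformContinuous_iff.1 (hup p) δ hδ
  obtain ⟨ε₂, hε₂, h₂⟩ : ∃ ε₂ : ℝ, 0 < ε₂ ∧ ∀ p, ε₂ ≤ ε₁ p := by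
    obtain h | h := isEmpty_or_nonempty (Fin m ⊕ Fin k)
    · exact ⟨1, one_pos, fun p => h.elim p⟩
    · obtain ⟨p, hp⟩ := Finite.exists_min ε₁
      exact ⟨ε₁ p, hε₁ p, hp⟩
  -- The bound by 1 keeps the support of the mollified function in a compact set independent of δ.
  let ε := min 1 (min ε₀ ε₂)
  have hε : 0 < ε := by positivity
  let ρ : ContDiffBump (0 : Pt m k) := ⟨ε / 2, ε, half_pos hε, half_lt_self hε⟩
  let L := ContinuousLinearMap.lsmul ℝ ℝ (E := ℝ)
  let ψ := MeasureTheory.convolution (ρ.normed volume) φ L volume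
  have hρi : LocallyIntegrable (ρ.normed (volume : Measure (Pt m k))) :=
    ρ.continuous_normed.locallyIntegrable
  have hpd : ∀ p X, pderiv p ψ X =
      MeasureTheory.convolution (ρ.normed volume) (pderiv p φ) L volume X := by
    intro p X
    unfold pderiv
    rw [(hφc.hasFDerivAt_convolution_right L hρi hφ X).fderiv,
      convolution_precompR_apply L hρi (hφc.fderiv ℝ) (hφ.continuous_fderiv one_ne_zero)]
  have hzero : ∀ X ∉ Metric.cthickening 1 (tsupport φ), ψ X = 0 := by
    intro X hX
    have := ρ.normed_convolution_eq_right (μ := volume) (g := φ) (x₀ := X) ?_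
    · rw [show ψ X = φ X from this]
      refine image_eq_zero_of_notMem_tsupport fun h => hX ?_
      exact Metric.self_subset_cthickening _ h
    · have h : ∀ Y ∈ Metric.ball X ρ.rOut, φ Y = 0 := by
        intro Y hY
        refine image_eq_zero_of_notMem_tsupport fun h => hX ?_
        refine Metric.mem_cthickening_of_dist_le X Y 1 _ h ?_
        rw [dist_comm]
        exact (Metric.mem_ball.1 hY).le.trans (min_le_left _ _)
      intro Y hY
      rw [h Y hY, h X (Metric.mem_ball_self ρ.rOut_pos)]
  refine ⟨ψ, ⟨?_, ?_⟩, hzero, fun X => ?_, fun p X => ?_⟩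
  · exact ρ.hasCompactSupport_normed.contDiff_convolution_left _ ρ.contDiff_normed
      hφ.continuous.locallyIntegrable
  · exact HasCompactSupport.intro hφc.isCompact.cthickening hzero
  · refine ρ.dist_normed_convolution_le hφ.continuous.aestronglyMeasurable fun Y hY => ?_
    exact (h₀ ((Metric.mem_ball.1 hY).trans_le
      ((min_le_right _ _).trans (min_le_left _ _)))).le
  · rw [hpd]
    refine ρ.dist_normed_convolution_le (continuous_pderiv hφ p).aestronglyMeasurable
      fun Y hY => ?_
    exact (h₁ p ((Metric.mem_ball.1 hY).trans_le
      (((min_le_right _ _).trans (min_le_right _ _)).trans (h₂ p)))).le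

/-- A weak divergence equation with locally integrable data that holds for smooth test functions
holds for test functions of class `C^1`. -/
theorem weak_eq_of_contDiff_one {h : Fin m ⊕ Fin k → Pt m k → ℝ} {g : Pt m k → ℝ}
    (hh : ∀ p, LocallyIntegrable (h p)) (hg : LocallyIntegrable g)
    (H : ∀ φ, IsTest φ → ∫ X, ((∑ p, h p X * pderiv p φ X) - g X * φ X) = 0)
    {φ : Pt m k → ℝ} (hφ : ContDiff ℝ 1 φ) (hφc : HasCompactSupport φ) :
    ∫ X, ((∑ p, h p X * pderiv p φ X) - g X * φ X) = 0 := by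
  have hint : ∀ χ : Pt m k → ℝ, ContDiff ℝ 1 χ → HasCompactSupport χ →
      Integrable fun X => (∑ p, h p X * pderiv p χ X) - g X * χ X := fun χ h1 h2 =>
    (integrable_finsetSum _ fun p _ => integrable_mul_of_hasCompactSupport (hh p)
      (continuous_pderiv h1 p) (hasCompactSupport_pderiv h2 p)).sub
      (integrable_mul_of_hasCompactSupport hg h1.continuous h2)
  let K := Metric.cthickening 1 (tsupport φ)
  have hK : IsCompact K := hφc.isCompact.cthickening
  let w : Pt m k → ℝ := fun X => (∑ p, |h p X|) + |g X|
  have hw : IntegrableOn w K :=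
    (integrable_finsetSum _ fun p _ => ((hh p).integrableOn_isCompact hK).abs).add
      (hg.integrableOn_isCompact hK).abs
  -- The integral vanishes for the smooth approximation ψ, and replacing φ by ψ costs at most δ
  -- times the mass of the data on the fixed compact set K.
  have hle : ∀ δ : ℝ, 0 < δ →
      |∫ X, ((∑ p, h p X * pderiv p φ X) - g X * φ X)| ≤ δ * ∫ X in K, w X := by
    intro δ hδ
    obtain ⟨ψ, hψ, hψK, h0, h1⟩ := exists_isTest_approx hφ hφc hδ
    have hψ1 : ContDiff ℝ 1 ψ := hψ.1.of_le (by exact_mod_cast le_top)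
    have hz : ∀ X ∉ K, ∀ p, pderiv p ψ X = 0 ∧ pderiv p φ X = 0 := by
      intro X hX p
      have hev : ∀ χ : Pt m k → ℝ, (∀ Y ∉ K, χ Y = 0) → pderiv p χ X = 0 := by
        intro χ hχ
        have : χ =ᶠ[nhds X] fun _ => 0 :=
          Filter.eventually_of_mem (Metric.isClosed_cthickening.isOpen_compl.mem_nhds hX) hχ
        unfold pderiv
        rw [this.fderiv_eq]
        simp
      exact ⟨hev ψ hψK, hev φ fun Y hY => image_eq_zero_of_notMem_tsupport fun h =>
        hY (Metric.self_subset_cthickening _ h)⟩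
    rw [← sub_zero (∫ X, _), ← H ψ hψ, ← integral_sub (hint φ hφ hφc) (hint ψ hψ1 hψ.2),
      ← integral_const_mul, ← integral_indicator hK.measurableSet]
    rw [← Real.norm_eq_abs]
    refine norm_integral_le_of_norm_le
      ((integrable_indicator_iff hK.measurableSet).2 (hw.const_mul δ)) (ae_of_all _ fun X => ?_)
    by_cases hX : X ∈ K
    · rw [indicator_of_mem hX, Real.norm_eq_abs]
      have e : (∑ p, h p X * pderiv p φ X) - g X * φ X -
          ((∑ p, h p X * pderiv p ψ X) - g X * ψ X) =
          (∑ p, h p X * (pderiv p φ X - pderiv p ψ X)) + g X * (ψ X - φ X) := by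
        simp only [mul_sub, Finset.sum_sub_distrib]
        ring
      rw [e]
      refine (abs_add_le _ _).trans ?_
      simp only [w]
      rw [mul_add, Finset.mul_sum]
      refine add_le_add ((Finset.abs_sum_le_sum_abs _ _).trans
        (Finset.sum_le_sum fun p _ => ?_)) ?_
      · rw [abs_mul, mul_comm, abs_sub_comm]
        exact mul_le_mul_of_nonneg_right (h1 p X) (abs_nonneg _)
      · rw [abs_mul, mul_comm]
        exact mul_le_mul_of_nonneg_right (h0 X) (abs_nonneg _)
    · rw [indicator_of_notMem hX]
      have hφX : φ X = 0 := image_eq_zero_of_notMem_tsupport fun h =>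
        hX (Metric.self_subset_cthickening _ h)
      simp [hz X hX, hψK X hX, hφX]
  have hlim : Filter.Tendsto (fun δ : ℝ => δ * ∫ X in K, w X) (nhdsWithin 0 (Ioi 0))
      (nhds (0 * ∫ X in K, w X)) :=
    (Filter.tendsto_id.mul_const _).mono_left nhdsWithin_le_nhds
  have := ge_of_tendsto hlim (Filter.eventually_of_mem self_mem_nhdsWithin hle)
  rw [zero_mul] at this
  exact abs_eq_zero.1 (this.antisymm (abs_nonneg _))

end Mollification

/-! ### Differentiating the system in the y-directions. -/

section Linearization

variable {m k n : ℕ}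

/-- Along lines in a y-direction x is frozen, so no differentiability in x of the coefficients or of
`F` is ever used. -/
theorem xPart_add_single_inr (X : Pt m k) (j : Fin k) (t : ℝ) :
    xPart (X + t • EuclideanSpace.single (Sum.inr j) (1 : ℝ)) = xPart X := by
  ext b
  simp [xPart]

theorem IsRegular.contDiff_two {u : Pt m k → ℝ} (hu : IsRegular u) (h : ∀ X, ∇ u X ≠ 0) :
    ContDiff ℝ 2 u := by
  rw [← contDiffOn_univ, ← eq_univ_of_forall (s := {X | ∇ u X ≠ 0}) h]
  exact hu.contDiffOn

theorem gradient_ne_zero {u : Pt m k → ℝ} {X : Pt m k} {p : Fin m ⊕ Fin k}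
    (h : pderiv p u X ≠ 0) : ∇ u X ≠ 0 := by
  intro h0
  apply h
  rw [← gradient_apply, h0]
  rfl

/-- The derivative in a `y`-direction of the flux `a(x,|∇u|) ∇u` is `𝒜 ∇(∂_y u)`. -/
theorem hasLineDerivAt_flux {a : E m → ℝ → ℝ} (ha : IsCoefficient a) {u : Pt m k → ℝ}
    (hu : ContDiff ℝ 2 u) {X : Pt m k} (hX : ∇ u X ≠ 0) (j : Fin k) (p : Fin m ⊕ Fin k) :
    HasLineDerivAt ℝ (fun Y => a (xPart Y) ‖∇ u Y‖ * pderiv p u Y)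
      ((matAlong a u X).mulVec (dvec (pderiv (Sum.inr j) u) X) p) X
      (EuclideanSpace.single (Sum.inr j) 1) := by
  have hnorm : 0 < ‖∇ u X‖ := norm_pos_iff.2 hX
  have hsum : 0 < ∑ q, pderiv q u X ^ 2 := by
    rw [norm_gradient] at hnorm
    exact Real.sqrt_pos.1 hnorm
  have hline : ∀ q, HasDerivAt
      (fun t : ℝ => pderiv q u (X + t • EuclideanSpace.single (Sum.inr j) (1 : ℝ)))
      (pderiv q (pderiv (Sum.inr j) u) X) 0 := by
    intro q
    rw [pderiv_comm hu]
    exact hasLineDerivAt_pderiv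
      ((contDiff_pderiv (s := 1) hu (by norm_num) q).differentiable (by norm_num) X) _
  have hs : HasDerivAt
      (fun t : ℝ => ∑ q, pderiv q u (X + t • EuclideanSpace.single (Sum.inr j) (1 : ℝ)) ^ 2)
      (∑ q, 2 * pderiv q u X * pderiv q (pderiv (Sum.inr j) u) X) 0 := by
    refine HasDerivAt.fun_sum fun q _ => ?_
    exact ((hline q).pow 2).congr_deriv (by simp)
  have hn : HasDerivAt
      (fun t : ℝ => ‖∇ u (X + t • EuclideanSpace.single (Sum.inr j) (1 : ℝ))‖)
      ((∑ q, pderiv q u X * pderiv q (pderiv (Sum.inr j) u) X) / ‖∇ u X‖) 0 := by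
    simp only [norm_gradient]
    refine (hs.sqrt (by simpa using hsum.ne')).congr_deriv ?_
    simp only [zero_smul, add_zero, mul_assoc, ← Finset.mul_sum]
    rw [mul_div_mul_left _ _ two_ne_zero]
  have hda : HasDerivAt (a (xPart X)) (deriv (a (xPart X)) ‖∇ u X‖)
      ‖∇ u (X + (0 : ℝ) • EuclideanSpace.single (Sum.inr j) (1 : ℝ))‖ := by
    simp only [zero_smul, add_zero]
    exact (((ha.contDiffOn (xPart X)).contDiffAt (Ioi_mem_nhds hnorm)).differentiableAt
      (by norm_num)).hasDerivAt
  have hfin := (hda.comp (0 : ℝ) hn).mul (hline p)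
  unfold HasLineDerivAt
  simp only [xPart_add_single_inr]
  refine hfin.congr_deriv ?_
  simp only [Function.comp_apply, zero_smul, add_zero, Matrix.mulVec, dotProduct, matAlong, matA,
    Matrix.of_apply, dvec, gradient_apply, add_mul, Finset.sum_add_distrib]
  rw [add_comm]
  congr 1
  · simp
  · rw [Finset.sum_div, Finset.mul_sum, Finset.sum_mul]
    refine Finset.sum_congr rfl fun q _ => ?_
    ring

theorem fderiv_apply_eq_sum (L : (Fin n → ℝ) →L[ℝ] ℝ) (w : Fin n → ℝ) :
    L w = ∑ l, L (Pi.single l 1) * w l := by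
  conv_lhs => rw [pi_eq_sum_univ' w]
  rw [map_sum]
  refine Finset.sum_congr rfl fun l _ => ?_
  rw [map_smul, smul_eq_mul, mul_comm]

theorem contDiff_dF {F : E m → (Fin n → ℝ) → ℝ} (hF : ∀ x, ContDiff ℝ 2 (F x)) (i : Fin n)
    (x : E m) : ContDiff ℝ 1 (dF F i x) :=
  ((hF x).fderiv_right (m := 1) (by norm_num)).clm_apply contDiff_const

theorem ddF_comm {F : E m → (Fin n → ℝ) → ℝ} (hF : ∀ x, ContDiff ℝ 2 (F x)) (i j : Fin n)
    (x : E m) (ξ : Fin n → ℝ) : ddF F i j x ξ = ddF F j i x ξ := by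
  have hd : DifferentiableAt ℝ (fderiv ℝ (F x)) ξ :=
    (((hF x).fderiv_right (m := 1) (by norm_num)).differentiable (by norm_num)) ξ
  have key : ∀ i j, ddF F i j x ξ =
      fderiv ℝ (fderiv ℝ (F x)) ξ (Pi.single j 1) (Pi.single i 1) := by
    intro i j
    unfold ddF
    rw [show dF F i x = fun ξ => fderiv ℝ (F x) ξ (Pi.single i 1) from rfl,
      fderiv_clm_apply hd (differentiableAt_const _)]
    simp
  rw [key, key]
  exact (hF x).contDiffAt.isSymmSndFDerivAt (by simp) _ _

theorem hasLineDerivAt_rhs {F : E m → (Fin n → ℝ) → ℝ} (hF : ∀ x, ContDiff ℝ 2 (F x))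
    {u : Fin n → Pt m k → ℝ} (hu : ∀ l, ContDiff ℝ 1 (u l)) (i : Fin n) (j : Fin k)
    (X : Pt m k) :
    HasLineDerivAt ℝ (fun Y => dF F i (xPart Y) fun l => u l Y)
      (∑ l, ddF F i l (xPart X) (fun l => u l X) * pderiv (Sum.inr j) (u l) X) X
      (EuclideanSpace.single (Sum.inr j) 1) := by
  have h1 : HasDerivAt
      (fun (t : ℝ) l => u l (X + t • EuclideanSpace.single (Sum.inr j) (1 : ℝ)))
      (fun l => pderiv (Sum.inr j) (u l) X) 0 :=
    hasDerivAt_pi.2 fun l => hasLineDerivAt_pderiv ((hu l).differentiable (by norm_num) X) _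
  have h2 : HasFDerivAt (dF F i (xPart X)) (fderiv ℝ (dF F i (xPart X)) fun l => u l X)
      (fun l => u l (X + (0 : ℝ) • EuclideanSpace.single (Sum.inr j) (1 : ℝ))) := by
    simp only [zero_smul, add_zero]
    exact ((contDiff_dF hF i _).differentiable (by norm_num) _).hasFDerivAt
  have h3 := h2.comp_hasDerivAt (0 : ℝ) h1
  unfold HasLineDerivAt
  simp only [xPart_add_single_inr]
  exact h3.congr_deriv (fderiv_apply_eq_sum _ _)

/-- Only differentiability along one direction is required of f: the flux and the right-hand side
may be irregular in x. -/
theorem integral_mul_pderiv_eq_neg {f f' φ : Pt m k → ℝ} {q : Fin m ⊕ Fin k}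
    (hf : LocallyIntegrable f) (hf' : LocallyIntegrable f')
    (hd : ∀ X, HasLineDerivAt ℝ f (f' X) X (EuclideanSpace.single q 1)) (hφ : IsTest φ) :
    ∫ X, f X * pderiv q φ X = -∫ X, f' X * φ X :=
  integral_bilinear_hasLineDerivAt_right_eq_neg_left_of_integrable
    (B := ContinuousLinearMap.mul ℝ ℝ)
    (integrable_mul_of_hasCompactSupport hf' hφ.1.continuous hφ.2)
    (integrable_mul_of_hasCompactSupport hf (hφ.pderiv q).1.continuous (hφ.pderiv q).2)
    (integrable_mul_of_hasCompactSupport hf hφ.1.continuous hφ.2)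
    (fun X _ => hd X) fun X _ => hasLineDerivAt_pderiv (hφ.1.differentiable (by simp) X) q

theorem locallyIntegrable_mulVec {M : Pt m k → Matrix (Fin m ⊕ Fin k) (Fin m ⊕ Fin k) ℝ}
    (hM : ∀ p q, LocallyIntegrable fun X => M X p q) {w : Pt m k → Fin m ⊕ Fin k → ℝ}
    (hw : Continuous w) (p : Fin m ⊕ Fin k) :
    LocallyIntegrable fun X => (M X).mulVec (w X) p := by
  have h : ∀ q ∈ Finset.univ, LocallyIntegrable fun X => M X p q * w X q := fun q _ =>
    locallyIntegrable_mul_continuous (hM p q) ((continuous_apply q).comp hw)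
  exact locallyIntegrable_finsetSum _ h

/-- The equation obtained by differentiating the system in the direction `y_j`. -/
theorem linearized_eq {a : Fin n → E m → ℝ → ℝ} (ha : ∀ i, IsCoefficient (a i))
    {F : E m → (Fin n → ℝ) → ℝ} (hF : ∀ x, ContDiff ℝ 2 (F x)) {u : Fin n → Pt m k → ℝ}
    (hu : IsWeakSolution a F u) (hu2 : ∀ i, ContDiff ℝ 2 (u i)) (hne : ∀ i X, ∇ (u i) X ≠ 0)
    (hF2 : ∀ i j, LocallyIntegrable fun X : Pt m k => ddF F i j (xPart X) fun l => u l X)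
    (hA : ∀ i p q, LocallyIntegrable fun X => matAlong (a i) (u i) X p q) (i : Fin n) (j : Fin k)
    {φ : Pt m k → ℝ} (hφ : ContDiff ℝ 1 φ) (hφc : HasCompactSupport φ) :
    ∫ X, ((∑ p, (matAlong (a i) (u i) X).mulVec (dvec (pderiv (Sum.inr j) (u i)) X) p *
      pderiv p φ X) - (∑ l, ddF F i l (xPart X) (fun l => u l X) *
        pderiv (Sum.inr j) (u l) X) * φ X) = 0 := by
  have hu1 : ∀ l, ContDiff ℝ 1 (u l) := fun l => (hu2 l).of_le (by norm_num)
  have hmv := fun p => locallyIntegrable_mulVec (hA i)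
    (continuous_dvec (contDiff_pderiv (s := 1) (hu2 i) (by norm_num) (Sum.inr j))) p
  have hrhs : LocallyIntegrable fun X => ∑ l, ddF F i l (xPart X) (fun l => u l X) *
      pderiv (Sum.inr j) (u l) X := locallyIntegrable_finsetSum _ fun l _ =>
    locallyIntegrable_mul_continuous (hF2 i l) (continuous_pderiv (hu1 l) _)
  refine weak_eq_of_contDiff_one hmv hrhs ?_ hφ hφc
  clear hφ hφc φ
  intro φ hφ
  have hφ2 : ContDiff ℝ 2 φ := contDiff_infty.1 hφ.1 2
  have hflux : ∀ p, LocallyIntegrable fun X => a i (xPart X) ‖∇ (u i) X‖ * pderiv p (u i) X := by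
    intro p
    simpa [gradient_apply] using locallyIntegrable_apply (hu.locallyIntegrable_flux i) p
  -- Testing with ∂_{y_j} φ and integrating by parts on both sides moves ∂_{y_j} onto the flux and
  -- onto the right-hand side.
  have hw := hu.weak_eq (fun _ => pderiv (Sum.inr j) φ) (fun _ => hφ.pderiv _) i
  have hl : ∀ X, inner ℝ (a i (xPart X) ‖∇ (u i) X‖ • ∇ (u i) X) (∇ (pderiv (Sum.inr j) φ) X) =
      ∑ p, a i (xPart X) ‖∇ (u i) X‖ * pderiv p (u i) X *
        pderiv (Sum.inr j) (pderiv p φ) X := by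
    intro X
    simp only [PiLp.inner_apply, PiLp.smul_apply, gradient_apply, smul_eq_mul]
    refine Finset.sum_congr rfl fun p _ => ?_
    rw [pderiv_comm hφ2 p]
    simp [mul_comm]
  simp only [hl] at hw
  rw [integral_mul_pderiv_eq_neg (hu.locallyIntegrable_rhs i) hrhs
      (hasLineDerivAt_rhs hF hu1 i j) hφ,
    integral_finsetSum _ fun p _ => integrable_mul_of_hasCompactSupport (hflux p)
      ((hφ.pderiv p).pderiv _).1.continuous ((hφ.pderiv p).pderiv _).2] at hw
  simp only [integral_mul_pderiv_eq_neg (hflux _) (hmv _)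
    (fun X => hasLineDerivAt_flux (ha i) (hu2 i) (hne i X) j _) (hφ.pderiv _)] at hw
  rw [integral_sub (integrable_finsetSum _ fun p _ => integrable_mul_of_hasCompactSupport (hmv p)
      (hφ.pderiv p).1.continuous (hφ.pderiv p).2)
      (integrable_mul_of_hasCompactSupport hrhs hφ.1.continuous hφ.2),
    integral_finsetSum _ fun p _ => integrable_mul_of_hasCompactSupport (hmv p)
      (hφ.pderiv p).1.continuous (hφ.pderiv p).2]
  rw [Finset.sum_neg_distrib] at hw
  linarith

end Linearization

/-! ### Cutoff functions. -/

section Cutoff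

variable {m k : ℕ}

theorem pderiv_comp_smul (f : Pt m k → ℝ) (r : ℝ) (p : Fin m ⊕ Fin k) (X : Pt m k) :
    pderiv p (fun Y => f (r • Y)) X = r * pderiv p f (r • X) := by
  unfold pderiv
  rw [fderiv_comp_smul]
  simp

/-- Cutoff functions between the balls of radius `r` and `2r`, with gradient of size `1/r`. -/
theorem exists_cutoff (m k : ℕ) : ∃ κ : ℝ, 0 ≤ κ ∧ ∀ r : ℝ, 0 < r → ∃ η : Pt m k → ℝ,
    ContDiff ℝ 1 η ∧ HasCompactSupport η ∧ (∀ X, 0 ≤ η X) ∧ (∀ X, η X ≤ 1) ∧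
    (∀ X ∈ Metric.ball 0 r, η X = 1 ∧ dvec η X = 0) ∧
    (∀ X ∉ Metric.ball 0 (2 * r), η X = 0 ∧ dvec η X = 0) ∧
    ∀ X, dvec η X ⬝ᵥ dvec η X ≤ κ / r ^ 2 := by
  let χ : ContDiffBump (0 : Pt m k) := ⟨1, 2, one_pos, one_lt_two⟩
  have hχ : ContDiff ℝ 1 χ := χ.contDiff
  have hcont : Continuous fun X => dvec χ X ⬝ᵥ dvec χ X :=
    (continuous_dvec hχ).dotProduct (continuous_dvec hχ)
  have hsupp : HasCompactSupport fun X => dvec χ X ⬝ᵥ dvec χ X := by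
    refine HasCompactSupport.intro χ.hasCompactSupport.isCompact fun X hX => ?_
    have h : fderiv ℝ χ X = 0 :=
      image_eq_zero_of_notMem_tsupport fun h => hX (tsupport_fderiv_subset ℝ h)
    have : dvec χ X = 0 := funext fun p => by simp [dvec, pderiv, h]
    simp [this]
  obtain ⟨κ, hκ⟩ := hcont.bounded_above_of_compact_support hsupp
  refine ⟨κ, (norm_nonneg _).trans (hκ 0), fun r hr => ?_⟩
  have hη : ContDiff ℝ 1 fun X : Pt m k => χ (r⁻¹ • X) := hχ.comp (contDiff_const_smul _)
  have hin : ∀ X ∈ Metric.ball (0 : Pt m k) r, χ (r⁻¹ • X) = 1 := by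
    intro X hX
    apply χ.one_of_mem_closedBall
    rw [mem_ball_zero_iff] at hX
    rw [mem_closedBall_zero_iff, norm_smul, norm_inv, Real.norm_of_nonneg hr.le]
    change r⁻¹ * ‖X‖ ≤ 1
    rw [inv_mul_le_iff₀ hr]
    linarith
  have hout : ∀ X ∉ Metric.ball (0 : Pt m k) (2 * r), χ (r⁻¹ • X) = 0 := by
    intro X hX
    apply χ.zero_of_le_dist
    rw [mem_ball_zero_iff, not_lt] at hX
    rw [dist_zero_right, norm_smul, norm_inv, Real.norm_of_nonneg hr.le]
    change 2 ≤ r⁻¹ * ‖X‖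
    rw [le_inv_mul_iff₀ hr]
    linarith
  have hz : ∀ X, fderiv ℝ (fun X : Pt m k => χ (r⁻¹ • X)) X = 0 →
      dvec (fun X : Pt m k => χ (r⁻¹ • X)) X = 0 := fun X h => by
    funext p
    simp [dvec, pderiv, h]
  refine ⟨fun X => χ (r⁻¹ • X), hη, ?_, fun X => χ.nonneg, fun X => χ.le_one,
    fun X hX => ⟨hin X hX, hz X ?_⟩, fun X hX => ⟨hout X hX, hz X ?_⟩, fun X => ?_⟩
  · refine HasCompactSupport.intro (isCompact_closedBall (0 : Pt m k) (2 * r)) fun X hX => ?_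
    exact hout X fun h => hX (Metric.ball_subset_closedBall h)
  -- Where the cutoff equals 1 it is maximal and where it equals 0 it is minimal, so its derivative
  -- vanishes there, including on the sphere of radius 2r.
  · apply IsLocalMax.fderiv_eq_zero
    exact Filter.Eventually.of_forall fun Y => by
      change χ (r⁻¹ • Y) ≤ χ (r⁻¹ • X)
      rw [hin X hX]
      exact χ.le_one
  · apply IsLocalMin.fderiv_eq_zero
    exact Filter.Eventually.of_forall fun Y => by
      change χ (r⁻¹ • X) ≤ χ (r⁻¹ • Y)
      rw [hout X hX]
      exact χ.nonneg
  · have h : dvec (fun X : Pt m k => χ (r⁻¹ • X)) X = r⁻¹ • dvec χ (r⁻¹ • X) :=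
      funext fun p => pderiv_comp_smul χ r⁻¹ p X
    rw [h, smul_dotProduct, dotProduct_smul, smul_eq_mul, smul_eq_mul]
    have := (le_abs_self _).trans (hκ (r⁻¹ • X))
    calc _ = (dvec χ (r⁻¹ • X) ⬝ᵥ dvec χ (r⁻¹ • X)) / r ^ 2 := by field_simp
      _ ≤ κ / r ^ 2 := by gcongr

end Cutoff

/-! ### A lemma on bounded monotone sequences. -/

section Real

/-- A nonnegative nondecreasing bounded sequence dominated by its increments vanishes. -/
theorem nonpos_of_le_mul_increment {D : ℕ → ℝ} {B K : ℝ} (hD : Monotone D) (hB : ∀ s, D s ≤ B)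
    (h : ∀ t : ℝ, 0 < t → ∀ s, D s ≤ t * (D (s + 1) - D s) + K / t) (s : ℕ) : D s ≤ 0 := by
  have hlim := tendsto_atTop_ciSup hD ⟨B, by rintro _ ⟨s, rfl⟩; exact hB s⟩
  set L := ⨆ s, D s
  -- The increments tend to 0 for fixed t as s → ∞; afterwards t → ∞.
  have hL : ∀ t : ℝ, 0 < t → L ≤ K / t := by
    intro t ht
    have h1 : Filter.Tendsto (fun s => t * (D (s + 1) - D s) + K / t) Filter.atTop
        (nhds (t * (L - L) + K / t)) :=
      (((((Filter.tendsto_add_atTop_iff_nat 1).2 hlim).sub hlim).const_mul t).add_const _)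
    have := le_of_tendsto_of_tendsto' hlim h1 (h t ht)
    simpa using this
  have hL0 : L ≤ 0 := by
    have h2 : Filter.Tendsto (fun t : ℝ => K / t) Filter.atTop (nhds 0) :=
      Filter.tendsto_id.const_div_atTop K
    exact ge_of_tendsto h2 (Filter.eventually_atTop.2 ⟨1, fun t ht => hL t (by linarith)⟩)
  exact (hD.ge_of_tendsto hlim s).trans hL0

end Real

/-! ### Quadratic forms of symmetric matrices. -/

section Matrix

variable {ι : Type*} [Fintype ι]

theorem dotProduct_mulVec_comm {M : Matrix ι ι ℝ} (hM : M.IsHermitian) (x y : ι → ℝ) :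
    M.mulVec x ⬝ᵥ y = M.mulVec y ⬝ᵥ x := by
  have h : M.transpose = M := by simpa using hM.eq
  rw [dotProduct_comm, Matrix.dotProduct_mulVec, ← Matrix.mulVec_transpose, h]

theorem mulVec_dotProduct_nonneg {M : Matrix ι ι ℝ} (hM : M.PosSemidef) (x : ι → ℝ) :
    0 ≤ M.mulVec x ⬝ᵥ x := by
  simpa [dotProduct_comm] using hM.dotProduct_mulVec_nonneg x

theorem eq_zero_of_mulVec_dotProduct_nonpos {M : Matrix ι ι ℝ} (hM : M.PosDef) {x : ι → ℝ}
    (h : M.mulVec x ⬝ᵥ x ≤ 0) : x = 0 := by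
  by_contra hx
  have := hM.dotProduct_mulVec_pos hx
  rw [star_trivial, dotProduct_comm] at this
  linarith

/-- Young's inequality for the form of M: expand its nonnegative value at t b x + c y and divide by
t. -/
theorem neg_two_mul_le_of_posSemidef {M : Matrix ι ι ℝ} (hM : M.PosSemidef) (x y : ι → ℝ)
    {t : ℝ} (ht : 0 < t) (b c : ℝ) :
    -(2 * b * c * (M.mulVec x ⬝ᵥ y)) ≤
      t * (b ^ 2 * (M.mulVec x ⬝ᵥ x)) + t⁻¹ * (c ^ 2 * (M.mulVec y ⬝ᵥ y)) := by
  have h := mulVec_dotProduct_nonneg hM ((t * b) • x + c • y)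
  simp only [Matrix.mulVec_add, Matrix.mulVec_smul, add_dotProduct, dotProduct_add,
    smul_dotProduct, dotProduct_smul, smul_eq_mul, dotProduct_mulVec_comm hM.1 y x] at h
  have h2 := mul_nonneg (inv_nonneg.2 ht.le) h
  have e : t⁻¹ * (t * b * (t * b * (M.mulVec x ⬝ᵥ x) + c * (M.mulVec x ⬝ᵥ y)) +
      c * (t * b * (M.mulVec x ⬝ᵥ y) + c * (M.mulVec y ⬝ᵥ y))) =
      t * (b ^ 2 * (M.mulVec x ⬝ᵥ x)) + 2 * b * c * (M.mulVec x ⬝ᵥ y) +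
        t⁻¹ * (c ^ 2 * (M.mulVec y ⬝ᵥ y)) := by
    field_simp
    ring
  linarith

/-- The spectrum of λ_max·1 - M is λ_max minus that of M, hence nonnegative, so this symmetric
matrix is positive semidefinite. -/
theorem mulVec_dotProduct_le_maxEigenvalue [DecidableEq ι] {M : Matrix ι ι ℝ}
    (hM : M.IsHermitian) (x : ι → ℝ) :
    M.mulVec x ⬝ᵥ x ≤ maxEigenvalue M * (x ⬝ᵥ x) := by
  have hbdd : BddAbove (spectrum ℝ M) := by
    rw [hM.spectrum_real_eq_range_eigenvalues]
    exact (finite_range _).bddAbove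
  have hN : (maxEigenvalue M • (1 : Matrix ι ι ℝ) - M).IsHermitian := by
    refine Matrix.IsHermitian.sub ?_ hM
    simp [Matrix.IsHermitian]
  have hpsd : (maxEigenvalue M • (1 : Matrix ι ι ℝ) - M).PosSemidef := by
    rw [hN.posSemidef_iff_eigenvalues_nonneg]
    intro i
    obtain ⟨μ, hμ⟩ : ∃ μ, μ = hN.eigenvalues i := ⟨_, rfl⟩
    have hi : μ ∈ spectrum ℝ (maxEigenvalue M • (1 : Matrix ι ι ℝ) - M) :=
      hμ ▸ hN.spectrum_real_eq_range_eigenvalues ▸ mem_range_self i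
    rw [← hμ]
    rw [← Algebra.algebraMap_eq_smul_one, ← spectrum.singleton_sub_eq] at hi
    obtain ⟨_, rfl, s, hs, h⟩ := mem_sub.1 hi
    rw [Pi.zero_apply, ← h]
    exact sub_nonneg.2 (le_csSup hbdd hs)
  have h := mulVec_dotProduct_nonneg hpsd x
  rw [Matrix.sub_mulVec, sub_dotProduct, Matrix.smul_mulVec, Matrix.one_mulVec,
    smul_dotProduct, smul_eq_mul] at h
  linarith

end Matrix

/-! ### Cooperative linear systems and the quotient of two solutions. -/

section Liouville

variable {m k n : ℕ}

/-- A cooperative linear system in divergence form, together with two solutions `v` and `v σ`. -/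
structure IsCooperativeSystem
    (M : Fin n → Pt m k → Matrix (Fin m ⊕ Fin k) (Fin m ⊕ Fin k) ℝ)
    (f : Fin n → Fin n → Pt m k → ℝ) (v σ : Fin n → Pt m k → ℝ) : Prop where
  locallyIntegrable_matrix : ∀ i p q, LocallyIntegrable fun X => M i X p q
  posDef : ∀ i, ∀ᵐ X, (M i X).PosDef
  locallyIntegrable_potential : ∀ i l, LocallyIntegrable (f i l)
  symm : ∀ i l X, f i l X = f l i X
  contDiff_left : ∀ i, ContDiff ℝ 1 (v i)
  contDiff_right : ∀ i, ContDiff ℝ 1 (σ i)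
  cooperative : ∀ i l, i ≠ l → ∀ X, 0 ≤ f i l X * v i X * v l X
  eq_left : ∀ i φ, ContDiff ℝ 1 φ → HasCompactSupport φ →
    ∫ X, ((M i X).mulVec (dvec (v i) X) ⬝ᵥ dvec φ X - (∑ l, f i l X * v l X) * φ X) = 0
  eq_mul : ∀ i φ, ContDiff ℝ 1 φ → HasCompactSupport φ →
    ∫ X, ((M i X).mulVec (dvec (fun Y => v i Y * σ i Y) X) ⬝ᵥ dvec φ X -
      (∑ l, f i l X * (v l X * σ l X)) * φ X) = 0

/-- The energy density of the quotient `σ`. -/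
noncomputable def gradDensity (M : Fin n → Pt m k → Matrix (Fin m ⊕ Fin k) (Fin m ⊕ Fin k) ℝ)
    (v σ : Fin n → Pt m k → ℝ) (X : Pt m k) : ℝ :=
  ∑ i, v i X ^ 2 * ((M i X).mulVec (dvec (σ i) X) ⬝ᵥ dvec (σ i) X)

/-- The coupling term `½ ∑ f_il v_i v_l (σ_i - σ_l)²`. -/
noncomputable def couplingDensity (f : Fin n → Fin n → Pt m k → ℝ) (v σ : Fin n → Pt m k → ℝ)
    (X : Pt m k) : ℝ :=
  (∑ i, ∑ l, f i l X * v i X * v l X * (σ i X - σ l X) ^ 2) / 2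

/-- Summation by parts: exchange i and l using the symmetry of c, then average the two expressions.
-/
theorem sum_mul_sub_mul_eq {c : Fin n → Fin n → ℝ} (hc : ∀ i l, c i l = c l i) (s : Fin n → ℝ) :
    ∑ i, (∑ l, c i l * (s l - s i)) * s i = -((∑ i, ∑ l, c i l * (s i - s l) ^ 2) / 2) := by
  have h1 : ∑ i, (∑ l, c i l * (s l - s i)) * s i = ∑ i, ∑ l, c i l * (s l - s i) * s i := by
    simp only [Finset.sum_mul]
  have h2 : ∑ i, ∑ l, c i l * (s l - s i) * s i = ∑ i, ∑ l, c i l * (s i - s l) * s l := by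
    rw [Finset.sum_comm]
    exact Finset.sum_congr rfl fun i _ => Finset.sum_congr rfl fun l _ => by rw [hc l i]
  have h3 : ∑ i, ∑ l, c i l * (s i - s l) ^ 2 =
      -(∑ i, ∑ l, c i l * (s l - s i) * s i + ∑ i, ∑ l, c i l * (s i - s l) * s l) := by
    rw [← Finset.sum_add_distrib, ← Finset.sum_neg_distrib]
    refine Finset.sum_congr rfl fun i _ => ?_
    rw [← Finset.sum_add_distrib, ← Finset.sum_neg_distrib]
    exact Finset.sum_congr rfl fun l _ => by ring
  rw [h3, h1, ← h2]
  ring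

theorem couplingDensity_nonneg {f : Fin n → Fin n → Pt m k → ℝ} {v σ : Fin n → Pt m k → ℝ}
    (h : ∀ i l, i ≠ l → ∀ X, 0 ≤ f i l X * v i X * v l X) (X : Pt m k) :
    0 ≤ couplingDensity f v σ X := by
  refine div_nonneg (Finset.sum_nonneg fun i _ => Finset.sum_nonneg fun l _ => ?_) zero_le_two
  by_cases hil : i = l
  · simp [hil]
  · exact mul_nonneg (h i l hil X) (sq_nonneg _)

theorem locallyIntegrable_mulVec_dotProduct
    {M : Pt m k → Matrix (Fin m ⊕ Fin k) (Fin m ⊕ Fin k) ℝ}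
    (hM : ∀ p q, LocallyIntegrable fun X => M X p q) {w z : Pt m k → Fin m ⊕ Fin k → ℝ}
    (hw : Continuous w) (hz : Continuous z) :
    LocallyIntegrable fun X => (M X).mulVec (w X) ⬝ᵥ z X := by
  have h : ∀ p ∈ Finset.univ, LocallyIntegrable fun X => (M X).mulVec (w X) p * z X p :=
    fun p _ => locallyIntegrable_mul_continuous (locallyIntegrable_mulVec hM hw p)
      ((continuous_apply p).comp hz)
  exact locallyIntegrable_finsetSum _ h

theorem integrable_mulVec_dotProduct
    {M : Pt m k → Matrix (Fin m ⊕ Fin k) (Fin m ⊕ Fin k) ℝ}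
    (hM : ∀ p q, LocallyIntegrable fun X => M X p q) {w : Pt m k → Fin m ⊕ Fin k → ℝ}
    (hw : Continuous w) {φ : Pt m k → ℝ} (hφ : ContDiff ℝ 1 φ) (hφc : HasCompactSupport φ) :
    Integrable fun X => (M X).mulVec (w X) ⬝ᵥ dvec φ X := by
  have h : ∀ p ∈ Finset.univ, Integrable fun X => (M X).mulVec (w X) p * pderiv p φ X :=
    fun p _ => integrable_mul_of_hasCompactSupport (locallyIntegrable_mulVec hM hw p)
      (continuous_pderiv hφ p) (hasCompactSupport_pderiv hφc p)
  exact integrable_finsetSum _ h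

variable {M : Fin n → Pt m k → Matrix (Fin m ⊕ Fin k) (Fin m ⊕ Fin k) ℝ}
  {f : Fin n → Fin n → Pt m k → ℝ} {v σ : Fin n → Pt m k → ℝ}

namespace IsCooperativeSystem

theorem locallyIntegrable_sum (hS : IsCooperativeSystem M f v σ) (i : Fin n)
    {w : Fin n → Pt m k → ℝ} (hw : ∀ l, Continuous (w l)) :
    LocallyIntegrable fun X => ∑ l, f i l X * w l X :=
  locallyIntegrable_finsetSum _ fun l _ =>
    locallyIntegrable_mul_continuous (hS.locallyIntegrable_potential i l) (hw l)

/-- The equation satisfied by the quotient `σ` of the two solutions. -/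
theorem quotient_eq (hS : IsCooperativeSystem M f v σ) (i : Fin n) {ψ : Pt m k → ℝ}
    (hψ : ContDiff ℝ 1 ψ) (hψc : HasCompactSupport ψ) :
    ∫ X, (v i X ^ 2 * ((M i X).mulVec (dvec (σ i) X) ⬝ᵥ dvec ψ X) -
      (∑ l, f i l X * v i X * v l X * (σ l X - σ i X)) * ψ X) = 0 := by
  have hv := hS.contDiff_left
  have hσ := hS.contDiff_right
  have hw : ∀ l, ContDiff ℝ 1 fun Y => v l Y * σ l Y := fun l => (hv l).mul (hσ l)
  have hvψ : ContDiff ℝ 1 fun Y => v i Y * ψ Y := (hv i).mul hψ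
  have hwψ : ContDiff ℝ 1 fun Y => v i Y * σ i Y * ψ Y := (hw i).mul hψ
  have hvψc : HasCompactSupport fun Y => v i Y * ψ Y := hψc.mul_left
  have hwψc : HasCompactSupport fun Y => v i Y * σ i Y * ψ Y := hψc.mul_left
  -- The equation for v σ is tested with v ψ and the one for v with v σ ψ. In the difference the
  -- terms without ∇σ cancel, and the two terms pairing ∇v with ∇σ cancel because the matrix is
  -- symmetric almost everywhere.
  have h1 := hS.eq_mul i _ hvψ hvψc
  have h2 := hS.eq_left i _ hwψ hwψc
  have hi1 := (integrable_mulVec_dotProduct (hS.locallyIntegrable_matrix i)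
    (continuous_dvec (hw i)) hvψ hvψc).sub (integrable_mul_of_hasCompactSupport
      (hS.locallyIntegrable_sum i fun l => (hw l).continuous) hvψ.continuous hvψc)
  have hi2 := (integrable_mulVec_dotProduct (hS.locallyIntegrable_matrix i)
    (continuous_dvec (hv i)) hwψ hwψc).sub (integrable_mul_of_hasCompactSupport
      (hS.locallyIntegrable_sum i fun l => (hv l).continuous) hwψ.continuous hwψc)
  have h3 := integral_sub hi1 hi2
  simp only [Pi.sub_apply] at h3
  rw [h1, h2, sub_zero] at h3
  rw [← h3]
  refine integral_congr_ae ?_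
  filter_upwards [hS.posDef i] with X hX
  have dv := (hv i).differentiable one_ne_zero X
  have dσ := (hσ i).differentiable one_ne_zero X
  have dψ := hψ.differentiable one_ne_zero X
  have dw : DifferentiableAt ℝ (fun Y => v i Y * σ i Y) X := dv.mul dσ
  rw [dvec_mul dv dψ, dvec_mul dw dψ, dvec_mul dv dσ]
  simp only [Matrix.mulVec_add, Matrix.mulVec_smul, add_dotProduct, dotProduct_add,
    smul_dotProduct, dotProduct_smul, smul_eq_mul,
    dotProduct_mulVec_comm hX.1 (dvec (v i) X) (dvec (σ i) X)]
  have e : ∑ l, f i l X * v i X * v l X * (σ l X - σ i X) =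
      v i X * (∑ l, f i l X * (v l X * σ l X)) -
        v i X * σ i X * ∑ l, f i l X * v l X := by
    rw [Finset.mul_sum, Finset.mul_sum, ← Finset.sum_sub_distrib]
    exact Finset.sum_congr rfl fun l _ => by ring
  rw [e]
  ring

theorem integrable_quotient (hS : IsCooperativeSystem M f v σ) (i : Fin n) {ψ : Pt m k → ℝ}
    (hψ : ContDiff ℝ 1 ψ) (hψc : HasCompactSupport ψ) :
    Integrable fun X => v i X ^ 2 * ((M i X).mulVec (dvec (σ i) X) ⬝ᵥ dvec ψ X) -
      (∑ l, f i l X * v i X * v l X * (σ l X - σ i X)) * ψ X := by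
  have hv := fun l => (hS.contDiff_left l).continuous
  have hσ := fun l => (hS.contDiff_right l).continuous
  refine Integrable.sub ?_ ?_
  · have h := integrable_mulVec_dotProduct (hS.locallyIntegrable_matrix i)
      (w := fun X => v i X ^ 2 • dvec (σ i) X)
      (((hv i).pow 2).smul (continuous_dvec (hS.contDiff_right i))) hψ hψc
    simpa [Matrix.mulVec_smul, smul_dotProduct] using h
  · refine integrable_mul_of_hasCompactSupport ?_ hψ.continuous hψc
    have h := hS.locallyIntegrable_sum i (w := fun l X => v i X * v l X * (σ l X - σ i X))
      fun l => ((hv i).mul (hv l)).mul ((hσ l).sub (hσ i))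
    simpa only [mul_assoc] using h

theorem locallyIntegrable_gradDensity (hS : IsCooperativeSystem M f v σ) :
    LocallyIntegrable (gradDensity M v σ) := by
  have h : ∀ i ∈ Finset.univ, LocallyIntegrable fun X =>
      v i X ^ 2 * ((M i X).mulVec (dvec (σ i) X) ⬝ᵥ dvec (σ i) X) := fun i _ => by
    have := locallyIntegrable_mul_continuous (locallyIntegrable_mulVec_dotProduct
      (hS.locallyIntegrable_matrix i) (continuous_dvec (hS.contDiff_right i))
      (continuous_dvec (hS.contDiff_right i))) ((hS.contDiff_left i).continuous.pow 2)
    simpa only [mul_comm, Pi.pow_apply] using this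
  exact locallyIntegrable_finsetSum _ h

theorem locallyIntegrable_couplingDensity (hS : IsCooperativeSystem M f v σ) :
    LocallyIntegrable (couplingDensity f v σ) := by
  have hv := fun l => (hS.contDiff_left l).continuous
  have hσ := fun l => (hS.contDiff_right l).continuous
  have h : ∀ i ∈ Finset.univ, LocallyIntegrable fun X =>
      ∑ l, f i l X * v i X * v l X * (σ i X - σ l X) ^ 2 := fun i _ => by
    have h := hS.locallyIntegrable_sum i (w := fun l X => v i X * v l X * (σ i X - σ l X) ^ 2)
      fun l => ((hv i).mul (hv l)).mul (((hσ i).sub (hσ l)).pow 2)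
    simpa only [mul_assoc] using h
  have := locallyIntegrable_mul_continuous (locallyIntegrable_finsetSum _ h)
    (continuous_const (y := (2⁻¹ : ℝ)))
  exact this

theorem ae_gradDensity_terms_nonneg (hS : IsCooperativeSystem M f v σ) :
    ∀ᵐ X, ∀ i, 0 ≤ v i X ^ 2 * ((M i X).mulVec (dvec (σ i) X) ⬝ᵥ dvec (σ i) X) := by
  filter_upwards [ae_all_iff.2 hS.posDef] with X hX i
  exact mul_nonneg (sq_nonneg _) (mulVec_dotProduct_nonneg (hX i).posSemidef _)

theorem ae_gradDensity_nonneg (hS : IsCooperativeSystem M f v σ) :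
    ∀ᵐ X, 0 ≤ gradDensity M v σ X := by
  filter_upwards [hS.ae_gradDensity_terms_nonneg] with X hX
  exact Finset.sum_nonneg fun i _ => hX i

/-- The quotient equation tested against `σ η²`. -/
theorem energy_eq (hS : IsCooperativeSystem M f v σ) {η : Pt m k → ℝ} (hη : ContDiff ℝ 1 η)
    (hηc : HasCompactSupport η) :
    Integrable (fun X => (gradDensity M v σ X + couplingDensity f v σ X) * η X ^ 2 +
      ∑ i, 2 * (v i X * η X) * (v i X * σ i X) *
        ((M i X).mulVec (dvec (σ i) X) ⬝ᵥ dvec η X)) ∧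
    ∫ X, ((gradDensity M v σ X + couplingDensity f v σ X) * η X ^ 2 +
      ∑ i, 2 * (v i X * η X) * (v i X * σ i X) *
        ((M i X).mulVec (dvec (σ i) X) ⬝ᵥ dvec η X)) = 0 := by
  have hη2 : ContDiff ℝ 1 fun Y => η Y * η Y := hη.mul hη
  have hψ : ∀ i, ContDiff ℝ 1 fun Y => σ i Y * (η Y * η Y) := fun i =>
    (hS.contDiff_right i).mul hη2
  have hψc : ∀ i, HasCompactSupport fun Y => σ i Y * (η Y * η Y) := fun i =>
    (hηc.mul_left (f := η)).mul_left
  have hpt : ∀ X, (gradDensity M v σ X + couplingDensity f v σ X) * η X ^ 2 +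
      ∑ i, 2 * (v i X * η X) * (v i X * σ i X) *
        ((M i X).mulVec (dvec (σ i) X) ⬝ᵥ dvec η X) =
      ∑ i, (v i X ^ 2 * ((M i X).mulVec (dvec (σ i) X) ⬝ᵥ
        dvec (fun Y => σ i Y * (η Y * η Y)) X) -
      (∑ l, f i l X * v i X * v l X * (σ l X - σ i X)) * (σ i X * (η X * η X))) := by
    intro X
    have hc := sum_mul_sub_mul_eq (c := fun i l => f i l X * v i X * v l X)
      (fun i l => by simp only [hS.symm i l X]; ring) (fun i => σ i X)
    have dη := hη.differentiable one_ne_zero X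
    have dη2 := hη2.differentiable one_ne_zero X
    have hH : couplingDensity f v σ X =
        -∑ i, (∑ l, f i l X * v i X * v l X * (σ l X - σ i X)) * σ i X := by
      rw [hc, neg_neg]
      rfl
    rw [hH, gradDensity, add_mul, neg_mul, Finset.sum_mul, Finset.sum_mul,
      ← Finset.sum_neg_distrib, ← Finset.sum_add_distrib, ← Finset.sum_add_distrib]
    refine Finset.sum_congr rfl fun i _ => ?_
    rw [dvec_mul ((hS.contDiff_right i).differentiable one_ne_zero X) dη2,
      dvec_mul dη dη]
    simp only [dotProduct_add, dotProduct_smul, smul_eq_mul]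
    ring
  simp only [hpt]
  have hi := fun i => hS.integrable_quotient i (hψ i) (hψc i)
  refine ⟨integrable_finsetSum _ fun i _ => hi i, ?_⟩
  rw [integral_finsetSum _ fun i _ => hi i]
  exact Finset.sum_eq_zero fun i _ => hS.quotient_eq i (hψ i) (hψc i)

end IsCooperativeSystem

end Liouville

/-! ### Energy estimates and the Liouville theorem. -/

section Liouville

variable {m k n : ℕ} {M : Fin n → Pt m k → Matrix (Fin m ⊕ Fin k) (Fin m ⊕ Fin k) ℝ}
  {f : Fin n → Fin n → Pt m k → ℝ} {v σ : Fin n → Pt m k → ℝ}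

/-- Quadratic growth is the critical rate: (κ / r²) · C (2r)² = 4 κ C does not depend on r. -/
theorem integral_mulVec_dotProduct_le {M : Pt m k → Matrix (Fin m ⊕ Fin k) (Fin m ⊕ Fin k) ℝ}
    (hM : ∀ᵐ X, (M X).PosDef) {w e η : Pt m k → ℝ}
    (he : ∀ᵐ X, ∀ x, w X ^ 2 * ((M X).mulVec x ⬝ᵥ x) ≤ e X * (x ⬝ᵥ x)) {C κ r : ℝ} (hr : 0 < r)
    (hκ : 0 ≤ κ) (hC0 : 0 ≤ C)
    (hC : ∫⁻ X in Metric.ball 0 (2 * r), ENNReal.ofReal (e X) ≤ ENNReal.ofReal (C * (2 * r) ^ 2))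
    (hout : ∀ X ∉ Metric.ball 0 (2 * r), dvec η X = 0)
    (hbd : ∀ X, dvec η X ⬝ᵥ dvec η X ≤ κ / r ^ 2)
    (hint : Integrable fun X => w X ^ 2 * ((M X).mulVec (dvec η X) ⬝ᵥ dvec η X)) :
    ∫ X, w X ^ 2 * ((M X).mulVec (dvec η X) ⬝ᵥ dvec η X) ≤ 4 * κ * C := by
  have hnn : 0 ≤ᵐ[volume] fun X => w X ^ 2 * ((M X).mulVec (dvec η X) ⬝ᵥ dvec η X) := by
    filter_upwards [hM] with X hX
    exact mul_nonneg (sq_nonneg _) (mulVec_dotProduct_nonneg hX.posSemidef _)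
  rw [integral_eq_lintegral_of_nonneg_ae hnn hint.aestronglyMeasurable]
  refine ENNReal.toReal_le_of_le_ofReal (by positivity) ?_
  calc ∫⁻ X, ENNReal.ofReal (w X ^ 2 * ((M X).mulVec (dvec η X) ⬝ᵥ dvec η X))
      ≤ ∫⁻ X, (Metric.ball (0 : Pt m k) (2 * r)).indicator
          (fun X => ENNReal.ofReal (κ / r ^ 2) * ENNReal.ofReal (e X)) X := by
        refine lintegral_mono_ae ?_
        filter_upwards [he] with X hX
        by_cases hb : X ∈ Metric.ball (0 : Pt m k) (2 * r)
        · rw [indicator_of_mem hb]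
          calc _ ≤ ENNReal.ofReal (dvec η X ⬝ᵥ dvec η X * e X) :=
                ENNReal.ofReal_le_ofReal ((hX _).trans_eq (mul_comm _ _))
            _ = ENNReal.ofReal (dvec η X ⬝ᵥ dvec η X) * ENNReal.ofReal (e X) :=
                ENNReal.ofReal_mul (Finset.sum_nonneg fun _ _ => mul_self_nonneg _)
            _ ≤ _ := by
                gcongr
                exact hbd X
        · simp [hout X hb]
    _ = ENNReal.ofReal (κ / r ^ 2) *
          ∫⁻ X in Metric.ball (0 : Pt m k) (2 * r), ENNReal.ofReal (e X) := by
        rw [lintegral_indicator measurableSet_ball, lintegral_const_mul' _ _ ENNReal.ofReal_ne_top]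
    _ ≤ ENNReal.ofReal (κ / r ^ 2) * ENNReal.ofReal (C * (2 * r) ^ 2) := by gcongr
    _ = ENNReal.ofReal (4 * κ * C) := by
        rw [← ENNReal.ofReal_mul (by positivity)]
        congr 1
        field_simp
        ring

namespace IsCooperativeSystem

/-- Two uses of Young's inequality in the energy identity. The first bounds the energy uniformly in
r; the second bounds it by its increment from r to 2r, since the cutoff term lives on that annulus.
-/
theorem energy_decay (hS : IsCooperativeSystem M f v σ) {e : Fin n → Pt m k → ℝ}
    (he : ∀ i, ∀ᵐ X, ∀ x, (v i X * σ i X) ^ 2 * ((M i X).mulVec x ⬝ᵥ x) ≤ e i X * (x ⬝ᵥ x))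
    {C : Fin n → ℝ} (hC0 : ∀ i, 0 ≤ C i) {R₀ : ℝ} (hR₀ : 0 < R₀)
    (hC : ∀ i, ∀ r : ℝ, R₀ ≤ r →
      ∫⁻ X in Metric.ball 0 r, ENNReal.ofReal (e i X) ≤ ENNReal.ofReal (C i * r ^ 2)) :
    ∃ K : ℝ, ∀ r, R₀ ≤ r →
      (∫ X in Metric.ball 0 r, (gradDensity M v σ X + couplingDensity f v σ X)) ≤ 4 * K ∧
      ∀ t : ℝ, 0 < t →
      (∫ X in Metric.ball 0 r, (gradDensity M v σ X + couplingDensity f v σ X)) ≤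
        t * ((∫ X in Metric.ball 0 (2 * r), (gradDensity M v σ X + couplingDensity f v σ X)) -
          ∫ X in Metric.ball 0 r, (gradDensity M v σ X + couplingDensity f v σ X)) + K / t := by
  obtain ⟨κ, hκ, hcut⟩ := exists_cutoff m k
  refine ⟨∑ i, 4 * κ * C i, fun r hr => ?_⟩
  have hr0 : 0 < r := hR₀.trans_le hr
  obtain ⟨η, hη, hηc, h0, h1, hin, hout, hbd⟩ := hcut r hr0
  set A : Pt m k → ℝ := fun X => gradDensity M v σ X + couplingDensity f v σ X with hAdef
  set T : Pt m k → ℝ := fun X => ∑ i, 2 * (v i X * η X) * (v i X * σ i X) *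
    ((M i X).mulVec (dvec (σ i) X) ⬝ᵥ dvec η X) with hTdef
  set P : Pt m k → ℝ := fun X => ∑ i, (v i X * σ i X) ^ 2 *
    ((M i X).mulVec (dvec η X) ⬝ᵥ dvec η X) with hPdef
  have hA : LocallyIntegrable A :=
    hS.locallyIntegrable_gradDensity.add hS.locallyIntegrable_couplingDensity
  have hAb : ∀ ρ, IntegrableOn A (Metric.ball 0 ρ) := fun ρ =>
    (hA.integrableOn_isCompact (isCompact_closedBall 0 ρ)).mono_set Metric.ball_subset_closedBall
  have hA0 : ∀ᵐ X, 0 ≤ A X := by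
    filter_upwards [hS.ae_gradDensity_nonneg] with X hX
    exact add_nonneg hX (couplingDensity_nonneg hS.cooperative X)
  have hAη : Integrable fun X => A X * η X ^ 2 :=
    integrable_mul_of_hasCompactSupport hA (hη.continuous.pow 2)
      (hηc.comp_left (g := fun s : ℝ => s ^ 2) (by norm_num))
  have hPi : ∀ i, Integrable fun X => (v i X * σ i X) ^ 2 *
      ((M i X).mulVec (dvec η X) ⬝ᵥ dvec η X) := fun i => by
    have h := integrable_mulVec_dotProduct (hS.locallyIntegrable_matrix i)
      (w := fun X => (v i X * σ i X) ^ 2 • dvec η X)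
      ((((hS.contDiff_left i).continuous.mul (hS.contDiff_right i).continuous).pow 2).smul
        (continuous_dvec hη)) hη hηc
    simpa [Matrix.mulVec_smul, smul_dotProduct] using h
  have hP : Integrable P := integrable_finsetSum _ fun i _ => hPi i
  have hPle : ∫ X, P X ≤ ∑ i, 4 * κ * C i := by
    rw [hPdef, integral_finsetSum _ fun i _ => hPi i]
    exact Finset.sum_le_sum fun i _ => integral_mulVec_dotProduct_le (hS.posDef i) (he i) hr0 hκ
      (hC0 i) (hC i (2 * r) (by linarith)) (fun X hX => (hout X hX).2) hbd (hPi i)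
  obtain ⟨hTA, hTA0⟩ := hS.energy_eq hη hηc
  have hT : Integrable T := by
    have := hTA.sub hAη
    refine this.congr (ae_of_all _ fun X => ?_)
    simp [A, T]
  have hq : ∫ X, A X * η X ^ 2 = ∫ X, -T X := by
    have := integral_add hAη hT
    rw [show ∫ X, (A X * η X ^ 2 + T X) = 0 from hTA0] at this
    rw [integral_neg]
    linarith
  have hDq : ∫ X in Metric.ball 0 r, A X ≤ ∫ X, A X * η X ^ 2 := by
    rw [← integral_indicator measurableSet_ball]
    refine integral_mono_ae ((hAb r).integrable_indicator measurableSet_ball) hAη ?_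
    filter_upwards [hA0] with X hX
    by_cases hb : X ∈ Metric.ball (0 : Pt m k) r
    · simp [indicator_of_mem hb, (hin X hb).1]
    · rw [indicator_of_notMem hb]
      positivity
  have hyoung : ∀ t : ℝ, 0 < t → ∀ᵐ X, -T X ≤ t * (A X * η X ^ 2) + t⁻¹ * P X := by
    intro t ht
    filter_upwards [ae_all_iff.2 hS.posDef] with X hX
    have h2 : -T X ≤ t * (gradDensity M v σ X * η X ^ 2) + t⁻¹ * P X := by
      simp only [hTdef, hPdef, gradDensity]
      rw [Finset.sum_mul, Finset.mul_sum, Finset.mul_sum, ← Finset.sum_neg_distrib,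
        ← Finset.sum_add_distrib]
      refine Finset.sum_le_sum fun i _ => ?_
      refine (neg_two_mul_le_of_posSemidef (hX i).posSemidef _ _ ht _ _).trans_eq ?_
      ring
    refine h2.trans ?_
    gcongr
    exact le_add_of_nonneg_right (couplingDensity_nonneg hS.cooperative X)
  have hT0 : ∀ X, dvec η X = 0 → T X = 0 := fun X hX => by simp [hTdef, hX]
  have hPnn : ∀ᵐ X, 0 ≤ P X := by
    filter_upwards [ae_all_iff.2 hS.posDef] with X hX
    exact Finset.sum_nonneg fun i _ =>
      mul_nonneg (sq_nonneg _) (mulVec_dotProduct_nonneg (hX i).posSemidef _)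
  constructor
  -- With t = 1/2 half of the energy is absorbed on the left, which leaves ∫ A η² ≤ 4 ∫ P.
  · have h : ∫ X, -T X ≤ ∫ X, (2⁻¹ * (A X * η X ^ 2) + (2⁻¹ : ℝ)⁻¹ * P X) :=
      integral_mono_ae hT.neg ((hAη.const_mul _).add (hP.const_mul _)) (hyoung _ (by norm_num))
    rw [integral_add (hAη.const_mul _) (hP.const_mul _), integral_const_mul,
      integral_const_mul, ← hq] at h
    linarith
  · intro t ht
    have hind : Integrable fun X => (Metric.ball 0 (2 * r)).indicator A X -
        (Metric.ball 0 r).indicator A X :=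
      ((hAb (2 * r)).integrable_indicator measurableSet_ball).sub
        ((hAb r).integrable_indicator measurableSet_ball)
    -- Off the annulus ∇η, and with it T, is zero, so Young's inequality is applied on the annulus
    -- only.
    have h : ∫ X, -T X ≤ ∫ X, (t * ((Metric.ball 0 (2 * r)).indicator A X -
        (Metric.ball 0 r).indicator A X) + t⁻¹ * P X) := by
      refine integral_mono_ae hT.neg ((hind.const_mul _).add (hP.const_mul _)) ?_
      filter_upwards [hA0, hPnn, hyoung t ht] with X hX hPX hy
      by_cases hb : X ∈ Metric.ball (0 : Pt m k) r
      · have hb2 : X ∈ Metric.ball (0 : Pt m k) (2 * r) :=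
          Metric.ball_subset_ball (by linarith) hb
        rw [hT0 X (hin X hb).2, indicator_of_mem hb, indicator_of_mem hb2, sub_self, mul_zero,
          zero_add, neg_zero]
        positivity
      · rw [indicator_of_notMem hb, sub_zero]
        by_cases hb2 : X ∈ Metric.ball (0 : Pt m k) (2 * r)
        · rw [indicator_of_mem hb2]
          refine hy.trans ?_
          have : η X ^ 2 ≤ 1 := pow_le_one₀ (h0 X) (h1 X)
          gcongr
          exact mul_le_of_le_one_right hX this
        · rw [hT0 X (hout X hb2).2, indicator_of_notMem hb2, mul_zero, zero_add, neg_zero]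
          positivity
    rw [integral_add (hind.const_mul _) (hP.const_mul _), integral_const_mul,
      integral_const_mul, integral_sub ((hAb (2 * r)).integrable_indicator measurableSet_ball)
      ((hAb r).integrable_indicator measurableSet_ball), integral_indicator measurableSet_ball,
      integral_indicator measurableSet_ball, ← hq] at h
    have h2 : t⁻¹ * ∫ X, P X ≤ (∑ i, 4 * κ * C i) / t := by
      rw [div_eq_inv_mul]
      gcongr
    linarith

/-- **Liouville theorem** for quotients of solutions of a cooperative system. -/
theorem liouville (hS : IsCooperativeSystem M f v σ) (hv : ∀ i X, v i X ≠ 0)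
    {e : Fin n → Pt m k → ℝ}
    (he : ∀ i, ∀ᵐ X, ∀ x, (v i X * σ i X) ^ 2 * ((M i X).mulVec x ⬝ᵥ x) ≤ e i X * (x ⬝ᵥ x))
    {C : Fin n → ℝ} (hC0 : ∀ i, 0 ≤ C i) {R₀ : ℝ} (hR₀ : 0 < R₀)
    (hC : ∀ i, ∀ r : ℝ, R₀ ≤ r →
      ∫⁻ X in Metric.ball 0 r, ENNReal.ofReal (e i X) ≤ ENNReal.ofReal (C i * r ^ 2)) :
    (∀ i X Y, σ i X = σ i Y) ∧ ∀ᵐ X, ∀ i l, i ≠ l → f i l X ≠ 0 → σ i X = σ l X := by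
  obtain ⟨K, hK⟩ := hS.energy_decay he hC0 hR₀ hC
  set A : Pt m k → ℝ := fun X => gradDensity M v σ X + couplingDensity f v σ X with hAdef
  have hA : LocallyIntegrable A :=
    hS.locallyIntegrable_gradDensity.add hS.locallyIntegrable_couplingDensity
  have hAb : ∀ ρ, IntegrableOn A (Metric.ball 0 ρ) := fun ρ =>
    (hA.integrableOn_isCompact (isCompact_closedBall 0 ρ)).mono_set Metric.ball_subset_closedBall
  have hA0 : ∀ᵐ X, 0 ≤ A X := by
    filter_upwards [hS.ae_gradDensity_nonneg] with X hX
    exact add_nonneg hX (couplingDensity_nonneg hS.cooperative X)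
  -- Doubling radii turn the annulus estimate into the increment condition of
  -- `nonpos_of_le_mul_increment`.
  let ρ : ℕ → ℝ := fun s => 2 ^ s * R₀
  have hρ : ∀ s, R₀ ≤ ρ s := fun s => le_mul_of_one_le_left hR₀.le (one_le_pow₀ one_le_two)
  have hρs : ∀ s, ρ (s + 1) = 2 * ρ s := fun s => by simp only [ρ]; ring
  have hmono : Monotone fun s => ∫ X in Metric.ball 0 (ρ s), A X := by
    refine monotone_nat_of_le_succ fun s => ?_
    refine setIntegral_mono_set (hAb _) (ae_restrict_of_ae hA0) ?_
    refine (Metric.ball_subset_ball ?_).eventuallyLE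
    rw [hρs]
    linarith [hρ s]
  have hD : ∀ s, ∫ X in Metric.ball 0 (ρ s), A X ≤ 0 :=
    nonpos_of_le_mul_increment hmono (fun s => (hK _ (hρ s)).1) fun t ht s => by
      simpa only [hρs] using (hK _ (hρ s)).2 t ht
  have hzero : ∀ᵐ X, A X = 0 := by
    have h : ∀ s, ∀ᵐ X, X ∈ Metric.ball 0 (ρ s) → A X = 0 := by
      intro s
      have h2 := (setIntegral_eq_zero_iff_of_nonneg_ae (ae_restrict_of_ae hA0) (hAb (ρ s))).1
        ((hD s).antisymm (integral_nonneg_of_ae (ae_restrict_of_ae hA0)))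
      exact (ae_restrict_iff' measurableSet_ball).1 h2
    filter_upwards [ae_all_iff.2 h] with X hX
    obtain ⟨s, hs⟩ := pow_unbounded_of_one_lt (‖X‖ / R₀) one_lt_two
    refine hX s (mem_ball_zero_iff.2 ?_)
    rwa [div_lt_iff₀ hR₀] at hs
  have hG : ∀ᵐ X, gradDensity M v σ X = 0 ∧ couplingDensity f v σ X = 0 := by
    filter_upwards [hzero, hS.ae_gradDensity_nonneg] with X h1 h2
    have h3 := couplingDensity_nonneg (σ := σ) hS.cooperative X
    simp only [hAdef] at h1
    exact ⟨by linarith, by linarith⟩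
  constructor
  · intro i
    have hd : ∀ᵐ X, dvec (σ i) X = 0 := by
      filter_upwards [hG, hS.ae_gradDensity_terms_nonneg, hS.posDef i] with X h1 h2 h3
      have h4 := (Finset.sum_eq_zero_iff_of_nonneg fun i _ => h2 i).1 h1.1 i (Finset.mem_univ i)
      refine eq_zero_of_mulVec_dotProduct_nonpos h3 ?_
      exact ((mul_eq_zero.1 h4).resolve_left (pow_ne_zero _ (hv i X))).le
    -- Definiteness and v_i ≠ 0 give ∇σ_i = 0 only almost everywhere; continuity of ∇σ_i gives it
    -- everywhere.
    have hd2 : dvec (σ i) = fun _ => 0 :=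
      (continuous_dvec (hS.contDiff_right i)).ae_eq_iff_eq volume continuous_const |>.1 hd
    refine is_const_of_fderiv_eq_zero ((hS.contDiff_right i).differentiable one_ne_zero)
      fun X => ?_
    refine ContinuousLinearMap.coe_injective ?_
    refine (EuclideanSpace.basisFun (Fin m ⊕ Fin k) ℝ).toBasis.ext fun p => ?_
    simpa [dvec, pderiv] using congrFun (congrFun hd2 X) p
  · filter_upwards [hG] with X hX i l hil hf
    have hterm : ∀ i l, 0 ≤ f i l X * v i X * v l X * (σ i X - σ l X) ^ 2 := fun i l => by
      by_cases h : i = l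
      · simp [h]
      · exact mul_nonneg (hS.cooperative i l h X) (sq_nonneg _)
    have h1 : ∑ i, ∑ l, f i l X * v i X * v l X * (σ i X - σ l X) ^ 2 = 0 :=
      (div_eq_zero_iff.1 hX.2).resolve_right two_ne_zero
    have h2 := (Finset.sum_eq_zero_iff_of_nonneg fun i _ =>
      Finset.sum_nonneg fun l _ => hterm i l).1 h1 i (Finset.mem_univ i)
    have h3 := (Finset.sum_eq_zero_iff_of_nonneg fun l _ => hterm i l).1 h2 l (Finset.mem_univ l)
    have h4 := (mul_eq_zero.1 h3).resolve_left
      (mul_ne_zero (mul_ne_zero hf (hv i X)) (hv l X))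
    exact sub_eq_zero.1 (pow_eq_zero_iff two_ne_zero |>.1 h4)

end IsCooperativeSystem

end Liouville

/-! ### From constant quotients to one-dimensional dependence on y. -/

section Symmetry

variable {m k n : ℕ}

theorem mkPt_zero_eq_sum (z : E k) :
    (mkPt 0 z : Pt m k) = ∑ j, z j • EuclideanSpace.single (Sum.inr j) (1 : ℝ) := by
  ext p
  rcases p with p | p <;> simp [mkPt, Pi.single_apply]

theorem fderiv_mkPt_zero (f : Pt m k → ℝ) (X : Pt m k) (z : E k) :
    fderiv ℝ f X (mkPt 0 z) = ∑ j, z j * pderiv (Sum.inr j) f X := by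
  rw [mkPt_zero_eq_sum, map_sum]
  exact Finset.sum_congr rfl fun j _ => by rw [map_smul]; rfl

theorem mkPt_add_smul (x : E m) (y z : E k) (t : ℝ) :
    (mkPt x (y + t • z) : Pt m k) = mkPt x y + t • mkPt 0 z := by
  ext p
  rcases p with p | p <;> simp [mkPt]

/-- A function whose `y`-gradient is parallel to a fixed vector `c` depends on `y` only through
`⟨c, y⟩`. -/
theorem eq_of_inner_eq_zero {f : Pt m k → ℝ} (hf : Differentiable ℝ f) {c : E k} {v : Pt m k → ℝ}
    (hc : ∀ j X, pderiv (Sum.inr j) f X = c j * v X) (x : E m) (y : E k) {z : E k}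
    (hz : inner ℝ c z = 0) : f (mkPt x (y + z)) = f (mkPt x y) := by
  have hd : ∀ t : ℝ, HasDerivAt (fun t : ℝ => f (mkPt x (y + t • z))) 0 t := by
    intro t
    have h1 : HasDerivAt (fun t : ℝ => (mkPt x y + t • mkPt 0 z : Pt m k)) (mkPt 0 z) t := by
      simpa using ((hasDerivAt_id t).smul_const (mkPt 0 z : Pt m k)).const_add (mkPt x y)
    have h2 := (hf (mkPt x y + t • mkPt 0 z)).hasFDerivAt.comp_hasDerivAt t h1
    simp only [mkPt_add_smul]
    refine h2.congr_deriv ?_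
    rw [fderiv_mkPt_zero]
    simp only [hc, ← mul_assoc, ← Finset.sum_mul]
    rw [PiLp.inner_apply] at hz
    simp only [RCLike.inner_apply, conj_trivial] at hz
    rw [hz, zero_mul]
  have := is_const_of_deriv_eq_zero (fun t => (hd t).differentiableAt) (fun t => (hd t).deriv) 1 0
  simpa using this

theorem sq_pderiv_le (f : Pt m k → ℝ) (X : Pt m k) (p : Fin m ⊕ Fin k) :
    pderiv p f X ^ 2 ≤ ‖∇ f X‖ ^ 2 := by
  rw [norm_gradient, Real.sq_sqrt (Finset.sum_nonneg fun _ _ => sq_nonneg _)]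
  exact Finset.single_le_sum (f := fun q => pderiv q f X ^ 2) (fun _ _ => sq_nonneg _)
    (Finset.mem_univ p)

theorem MatLocallyBounded.locallyIntegrable {a : E m → ℝ → ℝ} {u : Pt m k → ℝ}
    (hA : MatLocallyBounded a u) (hne : ∀ X, ∇ u X ≠ 0) (p q : Fin m ⊕ Fin k) :
    LocallyIntegrable fun X => matAlong a u X p q := by
  refine locallyIntegrable_of_memLp_top fun R hR => ?_
  have h := hA R hR p q
  rwa [eq_univ_of_forall (s := {X | ∇ u X ≠ 0}) hne, univ_inter] at h

/-- The `y`-gradients of the components of an `F`-monotone solution have constant directions. -/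
theorem exists_direction {a : Fin n → E m → ℝ → ℝ} (ha : ∀ i, IsCoefficient (a i))
    {F : E m → (Fin n → ℝ) → ℝ} (hF : ∀ x, ContDiff ℝ 2 (F x)) {u : Fin n → Pt m k → ℝ}
    (hu : IsWeakSolution a F u) (hreg : ∀ i, IsRegular (u i))
    (hF2 : ∀ i j, LocallyIntegrable fun X : Pt m k => ddF F i j (xPart X) fun l => u l X)
    {e : Fin k} (hmono : IsFMonotone e F u) (hA : ∀ i, MatLocallyBounded (a i) (u i))
    (hpos : ∀ i, ∀ᵐ X : Pt m k, (matAlong (a i) (u i) X).PosDef) (hE : EnergyGrowth a u) :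
    ∃ c : Fin n → E k, (∀ i, c i e = 1) ∧
      (∀ i j X, pderiv (Sum.inr j) (u i) X = c i j * pderiv (Sum.inr e) (u i) X) ∧
      ∀ᵐ X : Pt m k, ∀ i l, i ≠ l → ddF F i l (xPart X) (fun l => u l X) ≠ 0 → c i = c l := by
  have hne : ∀ i X, ∇ (u i) X ≠ 0 := fun i X => gradient_ne_zero (hmono.ne_zero i X)
  have hu2 : ∀ i, ContDiff ℝ 2 (u i) := fun i => (hreg i).contDiff_two (hne i)
  have hp1 : ∀ i j, ContDiff ℝ 1 (pderiv (Sum.inr j) (u i)) := fun i j =>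
    contDiff_pderiv (hu2 i) (by norm_num) _
  have hMi := fun i => (hA i).locallyIntegrable (hne i)
  let v : Fin n → Pt m k → ℝ := fun i => pderiv (Sum.inr e) (u i)
  let σ : Fin k → Fin n → Pt m k → ℝ := fun j i X =>
    pderiv (Sum.inr j) (u i) X / pderiv (Sum.inr e) (u i) X
  have hvσ : ∀ j i X, v i X * σ j i X = pderiv (Sum.inr j) (u i) X := fun j i X =>
    mul_div_cancel₀ _ (hmono.ne_zero i X)
  have hsymm : ∀ i l (X : Pt m k), ddF F i l (xPart X) (fun l => u l X) =
      ddF F l i (xPart X) (fun l => u l X) := fun i l X => ddF_comm hF i l _ _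
  have hS : ∀ j, IsCooperativeSystem (fun i X => matAlong (a i) (u i) X)
      (fun i l X => ddF F i l (xPart X) fun l => u l X) v (σ j) := fun j =>
    { locallyIntegrable_matrix := hMi
      posDef := hpos
      locallyIntegrable_potential := hF2
      symm := hsymm
      contDiff_left := fun i => hp1 i e
      contDiff_right := fun i => (hp1 i j).div (hp1 i e) (hmono.ne_zero i)
      cooperative := fun i l hil X => by
        rcases hil.lt_or_gt with h | h
        · exact hmono.nonneg i l h X
        · rw [hsymm, mul_right_comm]
          exact hmono.nonneg l i h X
      eq_left := fun i φ h1 h2 => linearized_eq ha hF hu hu2 hne hF2 hMi i e h1 h2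
      eq_mul := fun i φ h1 h2 => by
        simp only [hvσ]
        exact linearized_eq ha hF hu hu2 hne hF2 hMi i j h1 h2 }
  obtain ⟨C, hC1, hC⟩ := hE
  have hC0 : ∀ i, 0 ≤ C i := fun i => zero_le_one.trans (hC1 i)
  -- This radius dominates every C_j, and the summand 1 keeps it positive even when n = 0.
  have hR₀ : 0 < 1 + ∑ j, C j := by
    have := Finset.sum_nonneg fun j (_ : j ∈ Finset.univ) => hC0 j
    linarith
  have hCR : ∀ r, 1 + ∑ j, C j ≤ r → ∀ j, C j ≤ r := fun r hr j => by
    have := Finset.single_le_sum (fun j _ => hC0 j) (Finset.mem_univ j)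
    linarith
  -- No bound on the quotient itself is needed: v_i σ_i is a partial derivative of u^i, so its
  -- square is at most |∇u^i|² and the growth hypothesis applies.
  have key := fun j => (hS j).liouville hmono.ne_zero
    (e := fun i X => maxEigenvalue (matAlong (a i) (u i) X) * ‖∇ (u i) X‖ ^ 2) (fun i => by
      filter_upwards [hpos i] with X hX x
      rw [hvσ]
      calc _ ≤ ‖∇ (u i) X‖ ^ 2 * ((matAlong (a i) (u i) X).mulVec x ⬝ᵥ x) :=
            mul_le_mul_of_nonneg_right (sq_pderiv_le _ _ _)
              (mulVec_dotProduct_nonneg hX.posSemidef x)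
        _ ≤ ‖∇ (u i) X‖ ^ 2 * (maxEigenvalue (matAlong (a i) (u i) X) * (x ⬝ᵥ x)) :=
            mul_le_mul_of_nonneg_left (mulVec_dotProduct_le_maxEigenvalue hX.1 x) (sq_nonneg _)
        _ = _ := by ring) hC0 hR₀ fun i r hr => hC i r (hCR r hr)
  -- The quotients are constant, so their values at the origin give the vector c_i; its component e
  -- is v_i / v_i = 1, hence c_i ≠ 0.
  refine ⟨fun i => WithLp.toLp 2 fun j => σ j i 0, fun i => div_self (hmono.ne_zero i 0),
    fun i j X => ?_, ?_⟩
  · rw [← hvσ j i X, mul_comm, (key j).1 i X 0]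
  · filter_upwards [ae_all_iff.2 fun j => (key j).2] with X hX i l hil hf
    ext j
    change σ j i 0 = σ j l 0
    rw [(key j).1 i 0 X, (key j).1 l 0 X]
    exact hX j i l hil hf

theorem continuous_xPart_prodMk {u : Fin n → Pt m k → ℝ} (hu : ∀ l, Continuous (u l)) :
    Continuous fun X : Pt m k => (xPart X, fun l => u l X) := by
  refine Continuous.prodMk ?_ (continuous_pi hu)
  unfold xPart
  fun_prop

end Symmetry

end Fibered

/-! ### The main theorem. -/

theorem mainTheorem3 {m k n : ℕ} (hm : 1 ≤ m) (hk : 1 ≤ k)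
    (a : Fin n → Fibered.E m → ℝ → ℝ) (ha : ∀ i, Fibered.IsCoefficient (a i))
    (F : Fibered.E m → (Fin n → ℝ) → ℝ) (hF : ∀ x, ContDiff ℝ 2 (F x))
    (u : Fin n → Fibered.Pt m k → ℝ)
    (hu : Fibered.IsWeakSolution a F u)
    (hreg : ∀ i, Fibered.IsRegular (u i))
    (hF2 : ∀ i j, LocallyIntegrable fun X : Fibered.Pt m k =>
      Fibered.ddF F i j (Fibered.xPart X) fun l => u l X)
    (hmono : Fibered.IsFMonotone (⟨k - 1, Nat.sub_lt hk one_pos⟩ : Fin k) F u)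
    (hA : ∀ i, Fibered.MatLocallyBounded (a i) (u i))
    (hpos : ∀ i, ∀ᵐ X : Fibered.Pt m k, (Fibered.matAlong (a i) (u i) X).PosDef)
    (hE : Fibered.EnergyGrowth a u) :
    ∃ (ubar : Fin n → Fibered.E m → ℝ → ℝ) (dir : Fin n → Fibered.E k),
      (∀ i, ‖dir i‖ = 1) ∧
      (∀ i x y, u i (Fibered.mkPt x y) = ubar i x (inner ℝ (dir i) y)) ∧
      ∀ U : Set (Fibered.E m × (Fin n → ℝ)), IsOpen U →
        (∃ X : Fibered.Pt m k, (Fibered.xPart X, fun l => u l X) ∈ U) →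
        (∀ i j, (∀ q ∈ U, 0 < Fibered.ddF F i j q.1 q.2) ∨
          (∀ q ∈ U, Fibered.ddF F i j q.1 q.2 < 0)) →
        ∀ i j, dir i = dir j := by
  obtain ⟨c, hc1, hc, hcc⟩ :=
    Fibered.exists_direction ha hF hu hreg hF2 hmono hA hpos hE
  have hc0 : ∀ i, c i ≠ 0 := fun i h => by simpa [h] using hc1 i
  have hnorm : ∀ i, ‖‖c i‖⁻¹ • c i‖ = 1 := fun i => norm_smul_inv_norm (𝕜 := ℝ) (hc0 i)
  -- The profile is the restriction of u^i to the line spanned by the normalized c_i; y differs from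
  -- its projection onto that line by a vector orthogonal to c_i.
  refine ⟨fun i x s => u i (Fibered.mkPt x (s • ‖c i‖⁻¹ • c i)), fun i => ‖c i‖⁻¹ • c i, hnorm,
    fun i x y => ?_, fun U hU ⟨X₀, hX₀⟩ hsign i j => ?_⟩
  · set d := ‖c i‖⁻¹ • c i with hd
    have hz : inner ℝ (c i) (y - inner ℝ d y • d) = 0 := by
      have hcd : c i = ‖c i‖ • d := by
        rw [hd, smul_inv_smul₀ (norm_ne_zero_iff.2 (hc0 i))]
      rw [hcd, real_inner_smul_left, inner_sub_right, real_inner_smul_right,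
        real_inner_self_eq_norm_sq, hnorm i]
      ring
    have := Fibered.eq_of_inner_eq_zero ((hreg i).contDiff.differentiable one_ne_zero)
      (hc i) x (inner ℝ d y • d) hz
    rwa [add_sub_cancel] at this
  · have hopen := hU.preimage
      (Fibered.continuous_xPart_prodMk fun l => (hreg l).contDiff.continuous)
    -- The preimage of U is open and nonempty, hence of positive measure, and so contains a point
    -- where the almost everywhere statement on the coupling holds.
    obtain ⟨X, hXU, hX⟩ := ((frequently_ae_mem_iff.2
      (hopen.measure_pos volume ⟨X₀, hX₀⟩).ne').and_eventually hcc).exists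
    by_cases hij : i = j
    · rw [hij]
    · simp only [hX i j hij ((hsign i j).elim (fun h => (h _ hXU).ne') fun h => (h _ hXU).ne)]
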